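/- Let $d,n\in\mathbb N$, $0<p\le\infty$ and $r\in(0,1]$, and let $A_1,\dots,A_n$ be positive semidefinite $d\times d$ complex matrices. For a matrix $X$ put $|X|=(X^*X)^{1/2}$, let $\|X\|_p=(\operatorname{Tr}|X|^p)^{1/p}$ for $0<p<\infty$ be the Schatten $p$-(quasi-)norm, and let $\|X\|_\infty$ be the operator norm. Powers $A^z$ ($\operatorname{Re} z>0$) of a positive semidefinite matrix are taken by functional calculus with $0^z=0$, products are ordered, $\prod_{k=1}^nX_k=X_1X_2\cdots X_n$, and $\log 0=-\infty$. For $0<r<1$ let $$\beta_r(t)=\frac{\sin(\pi r)}{2r\,(\cosh(\pi t)+\cos(\pi r))},\qquad t\in\mathbb R,$$ and for $r=1$ let $\beta_1(t)\,dt$ denote the Dirac measure at $0$, the weak limit of $\beta_r(t)\,dt$ as $r\uparrow1$. Then $$\log\left\|\,\left|\prod_{k=1}^nA_k^{\,r}\right|^{1/r}\right\|_p\le\int_{-\infty}^{\infty}\beta_r(t)\,\log\left\|\prod_{k=1}^nA_k^{\,1+it}\right\|_p\,dt ,$$ where the function of $t$ under the logarithm is measurable and the positive part of the integrand has finite integral,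 so that the right-hand side is a well-defined element of $[-\infty,\infty)$. -/

import Mathlib

open scoped ENNReal ComplexOrder MatrixOrder Matrix.Norms.L2Operator

noncomputable section

/-- The complex power `A ^ z` of a positive semidefinite matrix `A`, by functional calculus:
an eigenvalue `a` is replaced by `a ^ z`, where `0 ^ z = 0` for `z ≠ 0`. -/
def matrixCpow {d : ℕ} (A : Matrix (Fin d) (Fin d) ℂ) (z : ℂ) : Matrix (Fin d) (Fin d) ℂ :=
  cfc (fun w : ℂ => w ^ z) A

/-- The Schatten (quasi-)norm: `(Tr |X| ^ p) ^ (1 / p)` with `|X| = (X* X) ^ (1 / 2)` for finite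
`p`, and the operator norm on Euclidean space for `p = ∞`. -/
def schattenNorm {d : ℕ} (p : ℝ≥0∞) (X : Matrix (Fin d) (Fin d) ℂ) : ℝ :=
  if p = ∞ then ‖X‖
  else (Matrix.trace (CFC.abs X ^ p.toReal)).re ^ (1 / p.toReal)

/-- `log ‖X‖_p` with values in `[-∞, ∞]`, so that `log 0 = -∞`. -/
def logSchattenNorm {d : ℕ} (p : ℝ≥0∞) (X : Matrix (Fin d) (Fin d) ℂ) : EReal :=
  ENNReal.log (ENNReal.ofReal (schattenNorm p X))

/-- The density `β_r(t) = sin (π r) / (2 r (cosh (π t) + cos (π r)))`. -/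
def hirschmanDensity (r t : ℝ) : ℝ :=
  Real.sin (Real.pi * r) / (2 * r * (Real.cosh (Real.pi * t) + Real.cos (Real.pi * r)))

/-- The measure `β_r(t) dt` for `0 < r ≤ 1`. For `r = 1` the formula for the density degenerates
(it is `0 / 0` at `t = 0` and `0` elsewhere); `β_1(t) dt` stands for the weak limit of
`β_r(t) dt` as `r` increases to `1`, which is the Dirac measure at `0`. -/
def hirschmanMeasure (r : ℝ) : MeasureTheory.Measure ℝ :=
  if r = 1 then MeasureTheory.Measure.dirac 0
  else MeasureTheory.volume.withDensity fun t => ENNReal.ofReal (hirschmanDensity r t)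

/-- The integral of an extended real valued function, as the integral of its positive part minus
the integral of its negative part. It is the usual one for a measurable function for which at
least one of the two is finite. -/
def erealIntegral {α : Type*} [MeasurableSpace α] (μ : MeasureTheory.Measure α)
    (f : α → EReal) : EReal :=
  ((∫⁻ x, (f x).toENNReal ∂μ : ℝ≥0∞) : EReal) - ((∫⁻ x, (-f x).toENNReal ∂μ : ℝ≥0∞) : EReal)

end

/-!
For positive definite `A_k`, the ordered product `F z = ∏ A_k ^ z` is an entire matrix function
that is bounded on the strip `0 ≤ Re z ≤ 1`, unitary on the line `Re z = 0`, and boundedly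
invertible on the line `Re z = 1`. The inequality is an interpolation between these two lines,
evaluated at `z = r`. It is proved at the level of singular values, which makes it insensitive to
whether `‖·‖_p` is a norm (`p ≥ 1`) or only a quasi-norm (`p < 1`).

* Scalar interpolation (`log_norm_le_integral_strip`). Jensen's inequality in the unit disc is
  transported to the strip by the conformal map sending `0` to `r`. The right boundary line receives
  harmonic measure `r β_r(t) dt`; the left one does not contribute when `|f| ≤ 1` there.
* Horn's inequality (`norm_det_minor_le`). For matrices `U`, `V` with `k` orthonormal columns,
  `|det (Vᴴ X U)|` is at most the product of the `k` largest singular values of `X`. It takes the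
  place of the identity `‖Λ^k X‖ = s_1 ⋯ s_k` for exterior powers.
* Log-majorization (`IsStripFamily.log_trace_le`). With `U`, `V` taken from the singular value
  decomposition of `F r`, scalar interpolation of `det (Vᴴ F U)` gives, for all `k`,
  `∑_{i ≤ k} log s_i (F r) / r ≤ ∫ ∑_{i ≤ k} log s_i (F (1 + it)) β_r(t) dt`. Since
  `y ↦ log ∑ exp (p y_i)` is convex, symmetric and increasing, its gradient inequality at
  `x_i = log s_i (F r) / r` and Abel summation turn this into the inequality of `log Tr |·|^p`.
* Semidefinite matrices are approximated by `A_k + ε`. The left side is continuous in `ε`, and a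
  reverse Fatou argument (`log_le_erealIntegral_of_tendsto`) controls the right side, where
  `log ‖·‖_p` may become `-∞`.
-/

open MeasureTheory Filter Topology Matrix

/-! ### The Hirschman measure and harmonic measure on the unit circle -/

/-- The angle `s ∈ (0, 2πθ)` of the boundary point of the unit disc that corresponds to the point
`1 + it` of the strip `0 ≤ Re z ≤ 1` under the conformal map sending `0` to `θ`. -/
noncomputable def stripArc (θ t : ℝ) : ℝ :=
  Real.pi - 2 * Real.arctan ((Real.exp (-(Real.pi * t)) + Real.cos (Real.pi * θ)) /
    Real.sin (Real.pi * θ))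

/-- The Cayley transform of the unit disc onto the upper half plane with `0 ↦ exp (iπθ)` maps the
boundary point `exp (is)` to the real number `-arcHeight θ s`. -/
noncomputable def arcHeight (θ s : ℝ) : ℝ :=
  Real.sin (Real.pi * θ - s / 2) / Real.sin (s / 2)

lemma sin_pi_mul_pos {θ : ℝ} (hθ : θ ∈ Set.Ioo (0 : ℝ) 1) : 0 < Real.sin (Real.pi * θ) :=
  Real.sin_pos_of_pos_of_lt_pi (mul_pos Real.pi_pos hθ.1)
    (by nlinarith [Real.pi_pos, hθ.2])

lemma cosh_add_cos_pos {θ : ℝ} (hθ : θ ∈ Set.Ioo (0 : ℝ) 1) (t : ℝ) :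
    0 < Real.cosh (Real.pi * t) + Real.cos (Real.pi * θ) := by
  have h1 := Real.one_le_cosh (Real.pi * t)
  have h2 : -1 < Real.cos (Real.pi * θ) := by
    have h3 := sin_pi_mul_pos hθ
    nlinarith [Real.sin_sq_add_cos_sq (Real.pi * θ), Real.neg_one_le_cos (Real.pi * θ)]
  linarith

lemma hirschmanDensity_pos {θ : ℝ} (hθ : θ ∈ Set.Ioo (0 : ℝ) 1) (t : ℝ) :
    0 < hirschmanDensity θ t :=
  div_pos (sin_pi_mul_pos hθ) (mul_pos (mul_pos two_pos hθ.1) (cosh_add_cos_pos hθ t))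

lemma hasDerivAt_stripArc {θ : ℝ} (hθ : θ ∈ Set.Ioo (0 : ℝ) 1) (t : ℝ) :
    HasDerivAt (stripArc θ) (2 * Real.pi * θ * hirschmanDensity θ t) t := by
  have hs := sin_pi_mul_pos hθ
  have hc := cosh_add_cos_pos hθ t
  have h1 : HasDerivAt (fun t : ℝ => Real.exp (-(Real.pi * t)))
      (Real.exp (-(Real.pi * t)) * (-(Real.pi * 1))) t :=
    ((hasDerivAt_id t).const_mul Real.pi).neg.exp
  have h2 := ((((h1.add_const (Real.cos (Real.pi * θ))).div_const
    (Real.sin (Real.pi * θ))).arctan).const_mul 2).const_sub Real.pi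
  refine h2.congr_deriv ?_
  unfold hirschmanDensity
  rw [Real.cosh_eq] at hc ⊢
  set c := Real.cos (Real.pi * θ)
  set s := Real.sin (Real.pi * θ)
  have hcs : s ^ 2 + c ^ 2 = 1 := Real.sin_sq_add_cos_sq _
  have he : Real.exp (Real.pi * t) = (Real.exp (-(Real.pi * t)))⁻¹ := by
    rw [Real.exp_neg, inv_inv]
  rw [he] at hc ⊢
  have hE := Real.exp_pos (-(Real.pi * t))
  set E := Real.exp (-(Real.pi * t))
  have hθ0 := hθ.1
  have hθ' : θ ≠ 0 := hθ0.ne'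
  have hd : s ^ 2 + (E + c) ^ 2 = 2 * E * ((E⁻¹ + E) / 2 + c) := by
    field_simp
    linear_combination hcs
  have e1 : 1 + ((E + c) / s) ^ 2 = 2 * E * ((E⁻¹ + E) / 2 + c) / s ^ 2 := by
    rw [← hd]; field_simp
  rw [e1]
  set D := (E⁻¹ + E) / 2 + c
  have hD : D ≠ 0 := hc.ne'
  field_simp

lemma arctan_cos_div_sin {x : ℝ} (h0 : 0 < x) (h1 : x < Real.pi) :
    Real.arctan (Real.cos x / Real.sin x) = Real.pi / 2 - x := by
  have : Real.cos x / Real.sin x = Real.tan (Real.pi / 2 - x) := by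
    rw [Real.tan_eq_sin_div_cos, Real.sin_pi_div_two_sub, Real.cos_pi_div_two_sub]
  rw [this, Real.arctan_tan] <;> linarith

lemma arcHeight_stripArc {θ : ℝ} (hθ : θ ∈ Set.Ioo (0 : ℝ) 1) (t : ℝ) :
    arcHeight θ (stripArc θ t) = Real.exp (-(Real.pi * t)) := by
  have hs := sin_pi_mul_pos hθ
  unfold arcHeight stripArc
  set q := (Real.exp (-(Real.pi * t)) + Real.cos (Real.pi * θ)) / Real.sin (Real.pi * θ) with hq
  have e : (Real.pi - 2 * Real.arctan q) / 2 = Real.pi / 2 - Real.arctan q := by ring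
  rw [e, Real.sin_sub, Real.sin_pi_div_two_sub, Real.cos_pi_div_two_sub]
  have hc := Real.cos_arctan_pos q
  have ht : Real.sin (Real.arctan q) = q * Real.cos (Real.arctan q) := by
    rw [← Real.tan_mul_cos hc.ne', Real.tan_arctan]
  rw [ht]
  have : q * Real.sin (Real.pi * θ) = Real.exp (-(Real.pi * t)) + Real.cos (Real.pi * θ) := by
    rw [hq]; field_simp
  rw [div_eq_iff hc.ne']
  linear_combination Real.cos (Real.arctan q) * this

lemma stripArc_mem {θ : ℝ} (hθ : θ ∈ Set.Ioo (0 : ℝ) 1) (t : ℝ) :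
    stripArc θ t ∈ Set.Ioo 0 (2 * Real.pi * θ) := by
  have hs := sin_pi_mul_pos hθ
  have hπ := Real.pi_pos
  have h1 : Real.arctan (Real.cos (Real.pi * θ) / Real.sin (Real.pi * θ)) <
      Real.arctan ((Real.exp (-(Real.pi * t)) + Real.cos (Real.pi * θ)) /
        Real.sin (Real.pi * θ)) := by
    apply Real.arctan_strictMono
    gcongr
    linarith [Real.exp_pos (-(Real.pi * t))]
  rw [arctan_cos_div_sin (mul_pos hπ hθ.1) (by nlinarith [hθ.2])] at h1
  have h2 := Real.arctan_lt_pi_div_two ((Real.exp (-(Real.pi * t)) + Real.cos (Real.pi * θ)) /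
        Real.sin (Real.pi * θ))
  unfold stripArc
  constructor <;> linarith

lemma arcHeight_pos {θ : ℝ} (hθ : θ ∈ Set.Ioo (0 : ℝ) 1) {s : ℝ}
    (hs : s ∈ Set.Ioo 0 (2 * Real.pi * θ)) : 0 < arcHeight θ s := by
  have hπ := Real.pi_pos
  have := hθ.1
  have := hθ.2
  apply div_pos
  · exact Real.sin_pos_of_pos_of_lt_pi (by linarith [hs.2]) (by nlinarith [hs.1])
  · exact Real.sin_pos_of_pos_of_lt_pi (by linarith [hs.1]) (by nlinarith [hs.2])

lemma stripArc_image {θ : ℝ} (hθ : θ ∈ Set.Ioo (0 : ℝ) 1) :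
    stripArc θ '' Set.univ = Set.Ioo 0 (2 * Real.pi * θ) := by
  have hπ := Real.pi_pos
  ext s
  constructor
  · rintro ⟨t, -, rfl⟩
    exact stripArc_mem hθ t
  · intro hs
    refine ⟨-Real.log (arcHeight θ s) / Real.pi, trivial, ?_⟩
    have hsin := sin_pi_mul_pos hθ
    have h2 : 0 < Real.sin (s / 2) :=
      Real.sin_pos_of_pos_of_lt_pi (by linarith [hs.1]) (by nlinarith [hs.2, hθ.2])
    have e : -(Real.pi * (-Real.log (arcHeight θ s) / Real.pi)) = Real.log (arcHeight θ s) := by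
      field_simp
    unfold stripArc
    rw [e, Real.exp_log (arcHeight_pos hθ hs)]
    have : (arcHeight θ s + Real.cos (Real.pi * θ)) / Real.sin (Real.pi * θ) =
        Real.cos (s / 2) / Real.sin (s / 2) := by
      unfold arcHeight
      rw [Real.sin_sub]
      field_simp
      ring
    rw [this, arctan_cos_div_sin (by linarith [hs.1]) (by nlinarith [hs.2, hθ.2])]
    ring

lemma stripArc_injective {θ : ℝ} (hθ : θ ∈ Set.Ioo (0 : ℝ) 1) :
    Function.Injective (stripArc θ) := by
  intro a b h
  have := congrArg (arcHeight θ) h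
  rw [arcHeight_stripArc hθ, arcHeight_stripArc hθ, Real.exp_eq_exp] at this
  have hπ := Real.pi_pos
  nlinarith

/-- The harmonic measure of the right boundary line, seen from `θ`, is the image of arc length. -/
lemma setIntegral_arc {θ : ℝ} (hθ : θ ∈ Set.Ioo (0 : ℝ) 1) (H : ℝ → ℝ) :
    ∫ s in Set.Ioo 0 (2 * Real.pi * θ), H s =
      2 * Real.pi * θ * ∫ t, hirschmanDensity θ t * H (stripArc θ t) := by
  rw [← stripArc_image hθ, integral_image_eq_integral_abs_deriv_smul MeasurableSet.univ
    (fun x _ => (hasDerivAt_stripArc hθ x).hasDerivWithinAt) (stripArc_injective hθ).injOn,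
    setIntegral_univ, ← integral_const_mul]
  refine integral_congr_ae (.of_forall fun t => ?_)
  have h0 := hirschmanDensity_pos hθ t
  have := hθ.1
  simp only [smul_eq_mul]
  rw [abs_of_pos (by positivity)]
  ring

lemma continuous_hirschmanDensity {θ : ℝ} (hθ : θ ∈ Set.Ioo (0 : ℝ) 1) :
    Continuous (hirschmanDensity θ) := by
  unfold hirschmanDensity
  refine continuous_const.div (by fun_prop) fun t => ?_
  exact (mul_pos (mul_pos two_pos hθ.1) (cosh_add_cos_pos hθ t)).ne'

lemma integral_hirschmanMeasure {θ : ℝ} (hθ : θ ∈ Set.Ioo (0 : ℝ) 1) (g : ℝ → ℝ) :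
    ∫ t, g t ∂(hirschmanMeasure θ) = ∫ t, hirschmanDensity θ t * g t := by
  unfold hirschmanMeasure
  rw [if_neg hθ.2.ne, integral_withDensity_eq_integral_toReal_smul
    (continuous_hirschmanDensity hθ).measurable.ennreal_ofReal (by simp)]
  refine integral_congr_ae (.of_forall fun t => ?_)
  simp [ENNReal.toReal_ofReal (hirschmanDensity_pos hθ t).le]

lemma integral_hirschmanDensity {θ : ℝ} (hθ : θ ∈ Set.Ioo (0 : ℝ) 1) :
    ∫ t, hirschmanDensity θ t = 1 := by
  have h := setIntegral_arc hθ (fun _ => 1)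
  have h0 : 0 < 2 * Real.pi * θ := by have := Real.pi_pos; have := hθ.1; positivity
  simp only [integral_const, MeasurableSet.univ, measureReal_restrict_apply, Set.univ_inter,
    Real.volume_real_Ioo_of_le h0.le, sub_zero, smul_eq_mul, mul_one] at h
  exact (mul_left_cancel₀ h0.ne' (by rw [mul_one]; exact h)).symm

lemma isProbabilityMeasure_hirschmanMeasure {θ : ℝ} (hθ : θ ∈ Set.Ioo (0 : ℝ) 1) :
    IsProbabilityMeasure (hirschmanMeasure θ) := by
  constructor
  have hint : Integrable (hirschmanDensity θ) := by
    by_contra h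
    have := integral_undef h
    rw [integral_hirschmanDensity hθ] at this
    exact one_ne_zero this
  unfold hirschmanMeasure
  rw [if_neg hθ.2.ne, withDensity_apply _ MeasurableSet.univ, Measure.restrict_univ,
    ← ofReal_integral_eq_lintegral_ofReal hint (.of_forall fun t => (hirschmanDensity_pos hθ t).le),
    integral_hirschmanDensity hθ, ENNReal.ofReal_one]

/-! ### Jensen's inequality in the unit disc and in the strip -/

lemma log_norm_le_circleAverage {g : ℂ → ℂ} (hg : DifferentiableOn ℂ g (Metric.ball 0 1))
    (h0 : g 0 ≠ 0) {ρ : ℝ} (hρ0 : 0 < ρ) (hρ1 : ρ < 1) :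
    Real.log ‖g 0‖ ≤ Real.circleAverage (fun z => Real.log ‖g z‖) 0 ρ := by
  have han : AnalyticOnNhd ℂ g (Metric.closedBall 0 |ρ|) := by
    rw [abs_of_pos hρ0]
    exact (hg.analyticOnNhd Metric.isOpen_ball).mono (Metric.closedBall_subset_ball hρ1)
  rw [AnalyticOnNhd.circleAverage_log_norm hρ0.ne' han h0]
  refine le_add_of_nonneg_left (finsum_nonneg fun u => ?_)
  by_cases hu : u ∈ Metric.closedBall (0 : ℂ) |ρ|
  · have hd := MeromorphicOn.AnalyticOnNhd.divisor_nonneg han u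
    have hd' : (0 : ℝ) ≤ (MeromorphicOn.divisor g (Metric.closedBall 0 |ρ|) u : ℝ) := by
      exact_mod_cast hd
    refine mul_nonneg hd' ?_
    rcases eq_or_ne u 0 with rfl | hu0
    · simp
    refine Real.log_nonneg ?_
    rw [zero_sub, norm_neg, ← div_eq_mul_inv, one_le_div (norm_pos_iff.mpr hu0)]
    simpa [abs_of_pos hρ0] using hu
  · simp [hu]

/-- For a bounded holomorphic function on the unit disc, Jensen's inequality persists in the limit
for radial boundary values; truncation of the modulus at `δ > 0` makes dominated convergence
applicable near zeros. -/
lemma log_norm_le_integral_of_tendsto {g : ℂ → ℂ} (hg : DifferentiableOn ℂ g (Metric.ball 0 1))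
    (h0 : g 0 ≠ 0) {C δ : ℝ} (hδ : 0 < δ) (hC : ∀ z ∈ Metric.ball (0 : ℂ) 1, ‖g z‖ ≤ C)
    {b : ℝ → ℝ} (hb : ∀ᵐ s, s ∈ Set.Ioc 0 (2 * Real.pi) →
      Tendsto (fun ρ : ℝ => ‖g (circleMap 0 ρ s)‖) (𝓝[<] 1) (𝓝 (b s))) :
    2 * Real.pi * Real.log ‖g 0‖ ≤ ∫ s in (0)..(2 * Real.pi), Real.log (max (b s) δ) := by
  have hmem : ∀ {ρ : ℝ}, 0 < ρ → ρ < 1 → ∀ s, circleMap 0 ρ s ∈ Metric.ball (0 : ℂ) 1 := by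
    intro ρ h1 h2 s
    simp [abs_of_pos h1, h2]
  have hpos : ∀ᶠ ρ : ℝ in 𝓝[<] 1, 0 < ρ ∧ ρ < 1 :=
    (Ioo_mem_nhdsLT (show (0 : ℝ) < 1 by norm_num))
  have hcont : ∀ {ρ : ℝ}, 0 < ρ → ρ < 1 →
      Continuous fun s : ℝ => Real.log (max ‖g (circleMap 0 ρ s)‖ δ) := by
    intro ρ h1 h2
    have : Continuous fun s : ℝ => g (circleMap 0 ρ s) :=
      hg.continuousOn.comp_continuous (continuous_circleMap 0 ρ) (hmem h1 h2)
    exact Continuous.log (this.norm.max continuous_const) fun s =>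
      (lt_of_lt_of_le hδ (le_max_right _ _)).ne'
  have hlim : Tendsto (fun ρ : ℝ => ∫ s in (0)..(2 * Real.pi),
      Real.log (max ‖g (circleMap 0 ρ s)‖ δ)) (𝓝[<] 1)
      (𝓝 (∫ s in (0)..(2 * Real.pi), Real.log (max (b s) δ))) := by
    refine intervalIntegral.tendsto_integral_filter_of_dominated_convergence
      (fun _ => |Real.log δ| + |Real.log (max C δ)|) ?_ ?_ (by simp) ?_
    · filter_upwards [hpos] with ρ hρ
      exact (hcont hρ.1 hρ.2).aestronglyMeasurable
    · filter_upwards [hpos] with ρ hρ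
      refine .of_forall fun s _ => ?_
      have h1 : Real.log δ ≤ Real.log (max ‖g (circleMap 0 ρ s)‖ δ) :=
        Real.log_le_log hδ (le_max_right _ _)
      have h2 : Real.log (max ‖g (circleMap 0 ρ s)‖ δ) ≤ Real.log (max C δ) :=
        Real.log_le_log (lt_of_lt_of_le hδ (le_max_right _ _))
          (max_le_max_right δ (hC _ (hmem hρ.1 hρ.2 s)))
      rw [Real.norm_eq_abs, abs_le]
      constructor
      · linarith [neg_abs_le (Real.log δ), abs_nonneg (Real.log (max C δ))]
      · linarith [le_abs_self (Real.log (max C δ)), abs_nonneg (Real.log δ)]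
    · filter_upwards [hb] with s hs hs'
      rw [Set.uIoc_of_le (by positivity)] at hs'
      exact (((hs hs').max tendsto_const_nhds).log (lt_of_lt_of_le hδ (le_max_right _ _)).ne')
  refine ge_of_tendsto hlim ?_
  filter_upwards [hpos] with ρ hρ
  have h := log_norm_le_circleAverage hg h0 hρ.1 hρ.2
  rw [Real.circleAverage_def, smul_eq_mul, inv_mul_eq_div, le_div_iff₀ (by positivity),
    mul_comm] at h
  refine h.trans (intervalIntegral.integral_mono_ae_restrict (by positivity) ?_
    ((hcont hρ.1 hρ.2).intervalIntegrable _ _) ?_)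
  · refine MeromorphicOn.circleIntegrable_log_norm (f := g) (c := 0) (R := ρ) ?_
    have han := hg.analyticOnNhd Metric.isOpen_ball
    refine (han.mono ?_).meromorphicOn
    rw [abs_of_pos hρ.1]
    exact Metric.sphere_subset_closedBall.trans (Metric.closedBall_subset_ball hρ.2)
  · -- The zeros of `g` on the circle, where `Real.log` takes its junk value, form a null set.
    have hne : ∀ᶠ z in codiscreteWithin (Metric.ball (0 : ℂ) 1), g z ≠ 0 := by
      refine ((hg.analyticOnNhd Metric.isOpen_ball).eqOn_zero_or_eventually_ne_zero_of_preconnected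
        (convex_ball (0 : ℂ) 1).isPreconnected).resolve_left fun h => h0 (h (by simp))
    have hne' : ∀ᶠ z in codiscreteWithin (Metric.sphere (0 : ℂ) |ρ|), g z ≠ 0 := by
      refine codiscreteWithin_mono ?_ hne
      rw [abs_of_pos hρ.1]
      exact Metric.sphere_subset_closedBall.trans (Metric.closedBall_subset_ball hρ.2)
    have hae : ∀ᵐ s ∂volume.restrict (Set.Icc 0 (2 * Real.pi)), g (circleMap 0 ρ s) ≠ 0 :=
      ae_restrict_le_codiscreteWithin measurableSet_Icc
        (codiscreteWithin_mono (Set.subset_univ _) (circleMap_preimage_codiscrete hρ.1.ne' hne'))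
    filter_upwards [hae] with s hs
    exact Real.log_le_log (norm_pos_iff.mpr hs) (le_max_left _ _)

open Complex in
/-- The Cayley transform mapping the unit disc onto the upper half plane, with `0 ↦ exp (iπθ)`. -/
noncomputable def cayley (θ : ℝ) (ζ : ℂ) : ℂ :=
  (exp (Real.pi * θ * I) - ζ * exp (-(Real.pi * θ * I))) / (1 - ζ)

open Complex in
/-- The conformal map of the unit disc onto the strip `0 < Re z < 1` with `0 ↦ θ`. -/
noncomputable def discToStrip (θ : ℝ) (ζ : ℂ) : ℂ :=
  -I * log (cayley θ ζ) / Real.pi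

open Complex in
lemma im_cayley (θ : ℝ) {ζ : ℂ} (hζ : ζ ≠ 1) :
    (cayley θ ζ).im = Real.sin (Real.pi * θ) * (1 - normSq ζ) / normSq (1 - ζ) := by
  have h1 : exp (Real.pi * θ * I) = ⟨Real.cos (Real.pi * θ), Real.sin (Real.pi * θ)⟩ := by
    rw [exp_mul_I]; apply Complex.ext <;> simp [← ofReal_mul, ← ofReal_cos, ← ofReal_sin]
  have h2 : exp (-(Real.pi * θ * I)) = ⟨Real.cos (Real.pi * θ), -Real.sin (Real.pi * θ)⟩ := by
    rw [← neg_mul, exp_mul_I]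
    apply Complex.ext <;> simp [← ofReal_mul, ← ofReal_cos, ← ofReal_sin]
  have h3 : normSq (1 - ζ) ≠ 0 := by rwa [Ne, normSq_eq_zero, sub_eq_zero, eq_comm]
  rw [cayley, h1, h2, div_im]
  field_simp
  simp only [normSq_apply, sub_re, sub_im, mul_re, mul_im, one_re, one_im]
  ring

open Complex in
lemma im_cayley_pos {θ : ℝ} (hθ : θ ∈ Set.Ioo (0 : ℝ) 1) {ζ : ℂ} (hζ : ‖ζ‖ < 1) :
    0 < (cayley θ ζ).im := by
  have h1 : ζ ≠ 1 := by rintro rfl; simp at hζ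
  rw [im_cayley θ h1]
  have : normSq ζ < 1 := by
    rw [normSq_eq_norm_sq]; nlinarith [norm_nonneg ζ]
  exact div_pos (mul_pos (sin_pi_mul_pos hθ) (by linarith))
    (normSq_pos.mpr (sub_ne_zero.mpr h1.symm))

open Complex in
lemma cayley_circleMap {θ s : ℝ} (hs : Real.sin (s / 2) ≠ 0) :
    cayley θ (circleMap 0 1 s) = ((-arcHeight θ s : ℝ) : ℂ) := by
  have e0 : circleMap 0 1 s = exp (s / 2 * I) * exp (s / 2 * I) := by
    rw [← exp_add, circleMap]; simp; congr 1; ring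
  have e1 : exp (Real.pi * θ * I) - circleMap 0 1 s * exp (-(Real.pi * θ * I)) =
      exp (s / 2 * I) * (2 * I * Complex.sin ((Real.pi * θ - s / 2 : ℝ) : ℂ)) := by
    rw [e0, Complex.sin]
    push_cast
    have a1 : exp (s / 2 * I) * exp (-(Real.pi * θ - s / 2) * I) =
        exp (s / 2 * I) * exp (s / 2 * I) * exp (-(Real.pi * θ * I)) := by
      rw [← exp_add, ← exp_add, ← exp_add]; congr 1; ring
    have a2 : exp (s / 2 * I) * exp ((Real.pi * θ - s / 2) * I) = exp (Real.pi * θ * I) := by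
      rw [← exp_add]; congr 1; ring
    linear_combination -(I ^ 2) * a1 + (I ^ 2) * a2 +
      (exp (Real.pi * θ * I) - exp (s / 2 * I) * exp (s / 2 * I) * exp (-(Real.pi * θ * I)))
        * I_sq
  have e2 : 1 - circleMap 0 1 s = -(exp (s / 2 * I) * (2 * I * Complex.sin ((s / 2 : ℝ) : ℂ))) := by
    rw [e0, Complex.sin]
    push_cast
    have a1 : exp (s / 2 * I) * exp (-(s / 2) * I) = 1 := by
      rw [← exp_add]; simp
    linear_combination (I ^ 2) * a1 +
      (-exp (s / 2 * I) * exp (s / 2 * I) + 1) * I_sq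
  have hs' : Complex.sin ((s / 2 : ℝ) : ℂ) ≠ 0 := by
    rw [← ofReal_sin]; exact_mod_cast hs
  rw [cayley, e1, e2, arcHeight]
  push_cast at hs' ⊢
  have := exp_ne_zero (s / 2 * I)
  have := I_ne_zero
  field_simp

open Complex in
lemma discToStrip_re_mem {θ : ℝ} (hθ : θ ∈ Set.Ioo (0 : ℝ) 1) {ζ : ℂ} (hζ : ‖ζ‖ < 1) :
    (discToStrip θ ζ).re ∈ Set.Ioo (0 : ℝ) 1 := by
  have him := im_cayley_pos hθ hζ
  have hre : (discToStrip θ ζ).re = arg (cayley θ ζ) / Real.pi := by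
    rw [discToStrip, div_ofReal_re]; simp [log_im]
  have h1 : arg (cayley θ ζ) ≠ 0 := fun h => by
    rw [arg_eq_zero_iff] at h; exact him.ne' h.2
  have h2 : arg (cayley θ ζ) ≠ Real.pi := fun h => by
    rw [arg_eq_pi_iff] at h; exact him.ne' h.2
  rw [hre]
  exact ⟨div_pos (lt_of_le_of_ne (arg_nonneg_iff.mpr him.le) h1.symm) Real.pi_pos,
    (div_lt_one Real.pi_pos).mpr (lt_of_le_of_ne (arg_le_pi _) h2)⟩

open Complex in
lemma discToStrip_zero {θ : ℝ} (hθ : θ ∈ Set.Ioo (0 : ℝ) 1) : discToStrip θ 0 = θ := by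
  have hπ := Real.pi_pos
  rw [discToStrip, cayley, zero_mul, sub_zero, sub_zero, div_one, Complex.log_exp]
  · have : (Real.pi : ℂ) ≠ 0 := by exact_mod_cast hπ.ne'
    field_simp
    linear_combination (-(θ : ℂ)) * I_sq
  · have : (Real.pi * θ * I : ℂ).im = Real.pi * θ := by simp
    rw [this]; nlinarith [hθ.1]
  · have : (Real.pi * θ * I : ℂ).im = Real.pi * θ := by simp
    rw [this]; nlinarith [hθ.2]

open Complex in
lemma differentiableOn_discToStrip {θ : ℝ} (hθ : θ ∈ Set.Ioo (0 : ℝ) 1) :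
    DifferentiableOn ℂ (discToStrip θ) (Metric.ball 0 1) := by
  intro ζ hζ
  rw [mem_ball_zero_iff] at hζ
  have h1 : (1 : ℂ) - ζ ≠ 0 := sub_ne_zero.mpr (by rintro rfl; simp at hζ)
  have hc : DifferentiableAt ℂ (cayley θ) ζ := by
    unfold cayley
    exact DifferentiableAt.div (by fun_prop) (by fun_prop) h1
  exact (((hc.clog (Or.inr (im_cayley_pos hθ hζ).ne')).const_mul (-I)).div_const
    (Real.pi : ℂ)).differentiableWithinAt

open Complex in
lemma tendsto_discToStrip {θ s : ℝ} (hθ : θ ∈ Set.Ioo (0 : ℝ) 1) (hs : Real.sin (s / 2) ≠ 0)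
    (hs' : arcHeight θ s ≠ 0) :
    Tendsto (fun ρ : ℝ => discToStrip θ (circleMap 0 ρ s)) (𝓝[<] 1)
      (𝓝 (-I * log ((-arcHeight θ s : ℝ) : ℂ) / Real.pi)) := by
  have h1 : (1 : ℂ) - circleMap 0 1 s ≠ 0 := by
    intro h
    have : circleMap 0 1 s = 1 := (sub_eq_zero.mp h).symm
    rw [circleMap] at this
    simp only [ofReal_one, one_mul, zero_add] at this
    obtain ⟨n, hn⟩ := Complex.exp_eq_one_iff.mp this
    have h2 : (s : ℂ) = n * (2 * Real.pi) := by
      have := I_ne_zero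
      apply mul_right_cancel₀ this
      rw [hn]; ring
    have h3 : s = n * (2 * Real.pi) := by exact_mod_cast h2
    apply hs
    rw [h3, show (n * (2 * Real.pi) / 2 : ℝ) = n * Real.pi by ring, Real.sin_int_mul_pi]
  have hc : Tendsto (fun ρ : ℝ => cayley θ (circleMap 0 ρ s)) (𝓝[<] 1)
      (𝓝 ((-arcHeight θ s : ℝ) : ℂ)) := by
    rw [← cayley_circleMap hs]
    have hcm : Continuous fun ρ : ℝ => circleMap 0 ρ s := by unfold circleMap; fun_prop
    have hcay : ContinuousAt (cayley θ) (circleMap 0 1 s) := by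
      unfold cayley
      exact ContinuousAt.div (by fun_prop) (by fun_prop) h1
    exact (hcay.tendsto.comp (hcm.tendsto 1)).mono_left nhdsWithin_le_nhds
  have hc' : Tendsto (fun ρ : ℝ => cayley θ (circleMap 0 ρ s)) (𝓝[<] 1)
      (𝓝[{z | 0 ≤ z.im}] ((-arcHeight θ s : ℝ) : ℂ)) := by
    refine tendsto_nhdsWithin_iff.mpr ⟨hc, ?_⟩
    filter_upwards [Ioo_mem_nhdsLT (show (0 : ℝ) < 1 by norm_num)] with ρ hρ
    exact (im_cayley_pos hθ (by simp [abs_of_pos hρ.1, hρ.2])).le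
  have hlog : ContinuousWithinAt log {z | 0 ≤ z.im} ((-arcHeight θ s : ℝ) : ℂ) := by
    rcases lt_or_gt_of_ne hs' with h | h
    · exact (continuousAt_clog (Or.inl (by simpa using h))).continuousWithinAt
    · exact continuousWithinAt_log_of_re_neg_of_im_zero (by simpa using h) (by simp)
  unfold discToStrip
  exact (((hlog.tendsto.comp hc').const_mul (-I)).div_const _)

/-- A quantitative three lines theorem (Hirschman): the harmonic measure of the strip seen from `θ`
assigns mass `θ` to the line `Re z = 1`, where it is distributed according to `hirschmanMeasure θ`,
and the bound `1` on the line `Re z = 0` makes the other boundary contribution nonpositive. -/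
theorem log_norm_le_integral_strip {f : ℂ → ℂ} (hf : Differentiable ℂ f) {C δ θ : ℝ}
    (hC : ∀ z : ℂ, 0 ≤ z.re → z.re ≤ 1 → ‖f z‖ ≤ C) (h0 : ∀ t : ℝ, ‖f (t * Complex.I)‖ ≤ 1)
    (hθ : θ ∈ Set.Ioo (0 : ℝ) 1) (hfθ : f θ ≠ 0) (hδ : 0 < δ) (hδ1 : δ ≤ 1) :
    Real.log ‖f θ‖ ≤
      θ * ∫ t : ℝ, Real.log (max ‖f (1 + t * Complex.I)‖ δ) ∂(hirschmanMeasure θ) := by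
  have hπ := Real.pi_pos
  have hθ0 := hθ.1
  have hθ1 := hθ.2
  have hle : 2 * Real.pi * θ ≤ 2 * Real.pi := by nlinarith
  set B : ℝ → ℂ := fun s => -Complex.I * Complex.log ((-arcHeight θ s : ℝ) : ℂ) / Real.pi with hB
  have hsin : ∀ s ∈ Set.Ioo 0 (2 * Real.pi), 0 < Real.sin (s / 2) := fun s hs =>
    Real.sin_pos_of_pos_of_lt_pi (by linarith [hs.1]) (by linarith [hs.2])
  -- The arc `(2πθ, 2π)` corresponds to the line `Re z = 0`.
  have hneg : ∀ s ∈ Set.Ioo (2 * Real.pi * θ) (2 * Real.pi), arcHeight θ s < 0 := fun s hs =>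
    div_neg_of_neg_of_pos
      (Real.sin_neg_of_neg_of_neg_pi_lt (by linarith [hs.1]) (by nlinarith [hs.2]))
      (hsin s ⟨lt_trans (by positivity) hs.1, hs.2⟩)
  have h := log_norm_le_integral_of_tendsto (g := fun ζ => f (discToStrip θ ζ))
    (hf.comp_differentiableOn (differentiableOn_discToStrip hθ))
    (by rwa [discToStrip_zero hθ]) (C := C) hδ
    (fun z hz => by
      have := discToStrip_re_mem hθ (mem_ball_zero_iff.mp hz)
      exact hC _ this.1.le this.2.le) (b := fun s => ‖f (B s)‖) (by
      have e1 : ∀ᵐ s : ℝ, s ≠ 2 * Real.pi * θ := by simp [ae_iff, measure_singleton]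
      have e2 : ∀ᵐ s : ℝ, s ≠ 2 * Real.pi := by simp [ae_iff, measure_singleton]
      filter_upwards [e1, e2] with s h1 h2 hs
      have hs2 : s ∈ Set.Ioo 0 (2 * Real.pi) := ⟨hs.1, lt_of_le_of_ne hs.2 h2⟩
      have hne : arcHeight θ s ≠ 0 := by
        rcases lt_or_gt_of_ne h1 with h | h
        · exact (arcHeight_pos hθ ⟨hs2.1, h⟩).ne'
        · exact (hneg s ⟨h, hs2.2⟩).ne
      exact (hf.continuous.norm.tendsto _).comp
        (tendsto_discToStrip hθ (hsin s hs2).ne' hne))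
  simp only [discToStrip_zero hθ] at h
  have hleft : ∀ s ∈ Set.Ioo (2 * Real.pi * θ) (2 * Real.pi),
      Real.log (max ‖f (B s)‖ δ) ≤ 0 := by
    intro s hs
    refine Real.log_nonpos (le_max_of_le_right hδ.le) (max_le ?_ hδ1)
    have : B s = ((-Real.log (-arcHeight θ s) / Real.pi : ℝ) : ℂ) * Complex.I := by
      simp only [hB]
      rw [← Complex.ofReal_log (by linarith [hneg s hs])]
      push_cast; ring
    rw [this]
    exact h0 _
  have hright : ∀ t, B (stripArc θ t) = 1 + t * Complex.I := by
    intro t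
    have hπ' : (Real.pi : ℂ) ≠ 0 := by exact_mod_cast hπ.ne'
    simp only [hB]
    have he : ((-Real.exp (-(Real.pi * t)) : ℝ) : ℂ) =
        Complex.exp ((-(Real.pi * t) : ℝ) + Real.pi * Complex.I) := by
      rw [Complex.exp_add, Complex.exp_pi_mul_I, ← Complex.ofReal_exp]; push_cast; ring
    rw [arcHeight_stripArc hθ, he, Complex.log_exp (by simp; linarith) (by simp)]
    push_cast
    field_simp
    linear_combination (-1 : ℂ) * Complex.I_sq
  have hBre : ∀ s, 0 ≤ (B s).re ∧ (B s).re ≤ 1 := by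
    intro s
    have hre : (B s).re = Complex.arg ((-arcHeight θ s : ℝ) : ℂ) / Real.pi := by
      simp only [hB]
      rw [Complex.div_ofReal_re]; simp [Complex.log_im]
    rw [hre]
    exact ⟨div_nonneg (Complex.arg_nonneg_iff.mpr (by simp)) hπ.le,
      (div_le_one hπ).mpr (Complex.arg_le_pi _)⟩
  have hmeas : Measurable fun s => Real.log (max ‖f (B s)‖ δ) := by
    have h1 : Measurable (arcHeight θ) := by unfold arcHeight; fun_prop
    have h2 : Measurable B := by simp only [hB]; fun_prop
    exact Real.measurable_log.comp
      (((hf.continuous.measurable.comp h2).norm).max measurable_const)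
  have hint : ∀ a b : ℝ, IntervalIntegrable (fun s => Real.log (max ‖f (B s)‖ δ)) volume a b := by
    intro a b
    refine (intervalIntegrable_const (c := |Real.log δ| + |Real.log (max C δ)|)).mono_fun
      hmeas.aestronglyMeasurable (.of_forall fun s => ?_)
    have h1 : Real.log δ ≤ Real.log (max ‖f (B s)‖ δ) :=
      Real.log_le_log hδ (le_max_right _ _)
    have h2 : Real.log (max ‖f (B s)‖ δ) ≤ Real.log (max C δ) :=
      Real.log_le_log (lt_of_lt_of_le hδ (le_max_right _ _))
        (max_le_max_right δ (hC _ (hBre s).1 (hBre s).2))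
    change |Real.log (max ‖f (B s)‖ δ)| ≤ |(|Real.log δ| + |Real.log (max C δ)|)|
    rw [abs_of_nonneg (show 0 ≤ |Real.log δ| + |Real.log (max C δ)| by positivity), abs_le]
    constructor
    · linarith [neg_abs_le (Real.log δ), abs_nonneg (Real.log (max C δ))]
    · linarith [le_abs_self (Real.log (max C δ)), abs_nonneg (Real.log δ)]
  rw [← intervalIntegral.integral_add_adjacent_intervals (hint 0 (2 * Real.pi * θ)) (hint _ _)] at h
  have h2 : ∫ s in (2 * Real.pi * θ)..(2 * Real.pi), Real.log (max ‖f (B s)‖ δ) ≤ 0 := by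
    have := intervalIntegral.integral_mono_on_of_le_Ioo hle (hint _ _)
      (intervalIntegrable_const (c := (0 : ℝ))) hleft
    simpa using this
  rw [intervalIntegral.integral_of_le (by positivity), integral_Ioc_eq_integral_Ioo,
    setIntegral_arc hθ] at h
  simp only [hright] at h
  rw [integral_hirschmanMeasure hθ]
  have h3 : 2 * Real.pi * Real.log ‖f θ‖ ≤ 2 * Real.pi * (θ * ∫ t : ℝ, hirschmanDensity θ t *
      Real.log (max ‖f (1 + t * Complex.I)‖ δ)) := by linarith
  exact le_of_mul_le_mul_left h3 (by positivity)

/-! ### Determinants of compressions -/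

section Determinants

variable {m n : Type*} [Fintype m] [DecidableEq m] [Fintype n] [DecidableEq n]

lemma Matrix.PosSemidef.one_le_det_one_add {P : Matrix n n ℂ} (hP : P.PosSemidef) :
    1 ≤ (1 + P).det := by
  have hs := hP.1.spectral_theorem
  rw [Unitary.conjStarAlgAut_apply] at hs
  have hdet : (1 + P).det = ∏ i, ((1 + hP.1.eigenvalues i : ℝ) : ℂ) := by
    conv_lhs => rw [hs]
    rw [mul_assoc, det_one_add_mul_comm, mul_assoc, Unitary.coe_star_mul_self,
      mul_one, ← diagonal_one, diagonal_add, det_diagonal]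
    refine Finset.prod_congr rfl fun i _ => ?_
    simp
  rw [hdet, ← Complex.ofReal_prod, ← Complex.ofReal_one, Complex.real_le_real]
  exact Finset.prod_induction _ (fun x : ℝ => 1 ≤ x)
    (fun _ _ h h' => one_le_mul_of_one_le_of_one_le h h') le_rfl
    fun i _ => by linarith [hP.eigenvalues_nonneg i]

/-- The determinant is monotone on positive semidefinite matrices. -/
lemma Matrix.PosSemidef.det_le_det_add {A C : Matrix n n ℂ} (hA : A.PosSemidef)
    (hC : C.PosSemidef) : A.det ≤ (A + C).det := by
  by_cases h : A.det = 0
  · rw [h]; exact (hA.add hC).det_nonneg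
  obtain ⟨S, hS⟩ := CStarAlgebra.nonneg_iff_eq_star_mul_self.mp (nonneg_iff_posSemidef.mpr hA)
  rw [star_eq_conjTranspose] at hS
  have hSdet : S.det ≠ 0 := by
    rintro h0; apply h; rw [hS, det_mul, h0, mul_zero]
  have hu : IsUnit S.det := isUnit_iff_ne_zero.mpr hSdet
  have hu' : IsUnit Sᴴ.det := by rw [det_conjTranspose]; exact hu.star
  have hfac : A + C = Sᴴ * (1 + (S⁻¹)ᴴ * C * S⁻¹) * S := by
    rw [mul_add, add_mul, mul_one, ← hS, conjTranspose_nonsing_inv]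
    congr 1
    rw [mul_assoc, mul_assoc, mul_assoc, nonsing_inv_mul _ hu, mul_one, ← mul_assoc,
      mul_nonsing_inv _ hu', one_mul]
  have h1 := (hC.conjTranspose_mul_mul_same S⁻¹).one_le_det_one_add
  rw [hfac, det_mul, det_mul, mul_right_comm, ← det_mul, ← hS]
  exact le_mul_of_one_le_right hA.det_nonneg h1

lemma posSemidef_one_sub_mul_conjTranspose {U : Matrix n m ℂ} (hU : Uᴴ * U = 1) :
    (1 - U * Uᴴ).PosSemidef := by
  have h : 1 - U * Uᴴ = (1 - U * Uᴴ)ᴴ * (1 - U * Uᴴ) := by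
    rw [conjTranspose_sub, conjTranspose_one, conjTranspose_mul, conjTranspose_conjTranspose,
      mul_sub, sub_mul, sub_mul, one_mul, mul_one, one_mul,
      show U * Uᴴ * (U * Uᴴ) = U * (Uᴴ * U) * Uᴴ by simp only [Matrix.mul_assoc], hU,
      Matrix.mul_one, sub_self, sub_zero]
  rw [h]
  exact posSemidef_conjTranspose_mul_self _

/-- A compression of `diag (a)` to a `k`-dimensional subspace has determinant at most the product
of the `k` largest `a i`. The ordering of the `a i` is replaced by a threshold `l`; the optimal
choice of `l` is the `k`-th largest value. After scaling to `l = 1` and raising the small `a i`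
to `1`, the compression is `1 + Uᴴ E U`, and `det (1 + Uᴴ E U) ≤ det (1 + E)`. -/
lemma det_compression_diagonal_le {U : Matrix n m ℂ} (hU : Uᴴ * U = 1) {a : n → ℝ}
    (ha : ∀ i, 0 ≤ a i) {l : ℝ} (hl : 0 < l) :
    (Uᴴ * diagonal (fun i => (a i : ℂ)) * U).det ≤
      ((l ^ Fintype.card m * ∏ i, max (a i / l) 1 : ℝ) : ℂ) := by
  set e : n → ℝ := fun i => max (a i / l) 1 - 1 with he
  have he0 : ∀ i, 0 ≤ e i := fun i => sub_nonneg.mpr (le_max_right _ _)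
  set R : Matrix n n ℂ := diagonal fun i => (Real.sqrt (e i) : ℂ) with hR
  have hRR : R * R = diagonal fun i => (e i : ℂ) := by
    rw [hR, diagonal_mul_diagonal]
    congr 1; funext i
    rw [← Complex.ofReal_mul, Real.mul_self_sqrt (he0 i)]
  have hRH : Rᴴ = R := by
    rw [hR, diagonal_conjTranspose]
    congr 1; funext i; simp
  have hpsd : (Uᴴ * diagonal (fun i => (a i : ℂ)) * U).PosSemidef := by
    refine PosSemidef.conjTranspose_mul_mul_same (PosSemidef.diagonal fun i => ?_) U
    exact Complex.zero_le_real.mpr (ha i)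
  have hC : (Uᴴ * diagonal (fun i => ((l * (1 + e i) - a i : ℝ) : ℂ)) * U).PosSemidef := by
    refine PosSemidef.conjTranspose_mul_mul_same (PosSemidef.diagonal fun i => ?_) U
    have : a i ≤ l * (1 + e i) := by
      have h1 : a i / l ≤ 1 + e i := by simp [he]
      rwa [div_le_iff₀' hl] at h1
    exact Complex.zero_le_real.mpr (sub_nonneg.mpr this)
  refine (hpsd.det_le_det_add hC).trans ?_
  have hsum : Uᴴ * diagonal (fun i => (a i : ℂ)) * U +
      Uᴴ * diagonal (fun i => ((l * (1 + e i) - a i : ℝ) : ℂ)) * U =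
      (l : ℂ) • (1 + (Uᴴ * R) * (R * U)) := by
    have e1 : diagonal (fun i => (a i : ℂ)) + diagonal (fun i => ((l * (1 + e i) - a i : ℝ) : ℂ)) =
        (l : ℂ) • (1 + R * R) := by
      rw [hRR, diagonal_add, ← diagonal_one, diagonal_add, ← diagonal_smul]
      congr 1; funext i; simp
    rw [← Matrix.add_mul, ← Matrix.mul_add, e1, Matrix.mul_smul, Matrix.smul_mul, Matrix.mul_add,
      Matrix.add_mul, Matrix.mul_one, hU]
    simp only [Matrix.mul_assoc]
  rw [hsum, det_smul, det_one_add_mul_comm]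
  have hpsd2 : (1 + R * U * (Uᴴ * R)).PosSemidef := by
    refine PosSemidef.one.add ?_
    have := posSemidef_self_mul_conjTranspose (R * U)
    rwa [conjTranspose_mul, hRH] at this
  have hC2 : (R * (1 - U * Uᴴ) * R).PosSemidef := by
    have := (posSemidef_one_sub_mul_conjTranspose hU).conjTranspose_mul_mul_same R
    rwa [hRH] at this
  have h2 := hpsd2.det_le_det_add hC2
  have hsum2 : 1 + R * U * (Uᴴ * R) + R * (1 - U * Uᴴ) * R =
      diagonal fun i => ((max (a i / l) 1 : ℝ) : ℂ) := by
    rw [mul_sub, sub_mul, mul_one, hRR]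
    rw [show R * U * (Uᴴ * R) = R * (U * Uᴴ) * R by simp only [Matrix.mul_assoc], add_assoc,
      add_sub_cancel, ← diagonal_one, diagonal_add]
    congr 1; funext i; simp [he]
  rw [hsum2, det_diagonal] at h2
  push_cast at h2 ⊢
  exact mul_le_mul_of_nonneg_left h2 (pow_nonneg (by exact_mod_cast hl.le) _)

/-- Horn's inequality for a compression `Vᴴ X U` to a `k`-dimensional space, in threshold form. -/
lemma norm_det_compression_sq_le {X : Matrix n n ℂ} {W : Matrix n n ℂ} {a : n → ℝ}
    (ha : ∀ i, 0 ≤ a i) (hW : Wᴴ * W = 1) (hX : Xᴴ * X = W * diagonal (fun i => (a i : ℂ)) * Wᴴ)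
    {U V : Matrix n m ℂ} (hU : Uᴴ * U = 1) (hV : Vᴴ * V = 1) {l : ℝ} (hl : 0 < l) :
    ‖(Vᴴ * X * U).det‖ ^ 2 ≤ l ^ Fintype.card m * ∏ i, max (a i / l) 1 := by
  have hpsd : ((Vᴴ * X * U)ᴴ * (Vᴴ * X * U)).PosSemidef := posSemidef_conjTranspose_mul_self _
  have hC := (posSemidef_one_sub_mul_conjTranspose hV).conjTranspose_mul_mul_same (X * U)
  have h := hpsd.det_le_det_add hC
  have hsum : (Vᴴ * X * U)ᴴ * (Vᴴ * X * U) + (X * U)ᴴ * (1 - V * Vᴴ) * (X * U) =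
      (Wᴴ * U)ᴴ * diagonal (fun i => (a i : ℂ)) * (Wᴴ * U) := by
    have e1 : (Wᴴ * U)ᴴ * diagonal (fun i => (a i : ℂ)) * (Wᴴ * U) = Uᴴ * (Xᴴ * X) * U := by
      rw [hX, conjTranspose_mul, conjTranspose_conjTranspose]; simp only [Matrix.mul_assoc]
    rw [e1, Matrix.mul_sub, Matrix.sub_mul, Matrix.mul_one]
    simp only [conjTranspose_mul, conjTranspose_conjTranspose, Matrix.mul_assoc]
    abel
  have hW' : W * Wᴴ = 1 := mul_eq_one_comm.mp hW
  have hWU : (Wᴴ * U)ᴴ * (Wᴴ * U) = 1 := by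
    rw [conjTranspose_mul, conjTranspose_conjTranspose, Matrix.mul_assoc, ← Matrix.mul_assoc W,
      hW', Matrix.one_mul, hU]
  rw [hsum] at h
  have h3 := h.trans (det_compression_diagonal_le hWU ha hl)
  rw [det_mul, det_conjTranspose] at h3
  have h4 : star (Vᴴ * X * U).det * (Vᴴ * X * U).det =
      ((‖(Vᴴ * X * U).det‖ ^ 2 : ℝ) : ℂ) := by
    rw [← Complex.normSq_eq_norm_sq]; exact Complex.normSq_eq_conj_mul_self.symm
  rw [h4, Complex.real_le_real] at h3
  exact h3

end Determinants

/-! ### Singular values -/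

lemma Matrix.PosSemidef.rpow_eq {d : ℕ} {A : Matrix (Fin d) (Fin d) ℂ} (hA : A.PosSemidef)
    (q : ℝ) : A ^ q = (hA.1.eigenvectorUnitary : Matrix (Fin d) (Fin d) ℂ) *
      diagonal (fun i => ((hA.1.eigenvalues i ^ q : ℝ) : ℂ)) *
      (hA.1.eigenvectorUnitary : Matrix (Fin d) (Fin d) ℂ)ᴴ := by
  rw [CFC.rpow_eq_cfc_real (a := A) (y := q) (nonneg_iff_posSemidef.mpr hA), hA.1.cfc_eq]
  rw [Matrix.IsHermitian.cfc, Unitary.conjStarAlgAut_apply]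
  rfl

/-- Singular value decomposition `Vᴴ X U = diag (s)` of an invertible matrix, with the singular
values in decreasing order. -/
theorem exists_sorted_svd {d : ℕ} {X : Matrix (Fin d) (Fin d) ℂ} (hX : IsUnit X) :
    ∃ (U V : Matrix (Fin d) (Fin d) ℂ) (s : Fin d → ℝ), Uᴴ * U = 1 ∧ Vᴴ * V = 1 ∧
      (∀ i, 0 < s i) ∧ Antitone s ∧ Vᴴ * X * U = diagonal (fun i => (s i : ℂ)) ∧
      Xᴴ * X = U * diagonal (fun i => ((s i ^ 2 : ℝ) : ℂ)) * Uᴴ ∧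
      ∀ q : ℝ, (trace (CFC.abs X ^ q)).re = ∑ i, s i ^ q := by
  have hH : (CFC.abs X).PosSemidef := nonneg_iff_posSemidef.mp (CFC.abs_nonneg X)
  set W : Matrix (Fin d) (Fin d) ℂ := (hH.1.eigenvectorUnitary : Matrix (Fin d) (Fin d) ℂ) with hW
  set v := hH.1.eigenvalues with hv
  have hWW : Wᴴ * W = 1 := Unitary.coe_star_mul_self hH.1.eigenvectorUnitary
  have hrpow := hH.rpow_eq
  have habs : CFC.abs X = W * diagonal (fun i => (v i : ℂ)) * Wᴴ := by
    have := hrpow 1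
    simp only [Real.rpow_one] at this
    rwa [CFC.rpow_one _ (CFC.abs_nonneg X)] at this
  have hXX : Xᴴ * X = W * diagonal (fun i => ((v i ^ 2 : ℝ) : ℂ)) * Wᴴ := by
    have h1 : CFC.abs X * CFC.abs X = Xᴴ * X := CFC.abs_mul_abs X
    rw [← h1, habs]
    have e : W * diagonal (fun i => (v i : ℂ)) * Wᴴ * (W * diagonal (fun i => (v i : ℂ)) * Wᴴ) =
      W * (diagonal (fun i => (v i : ℂ)) * (Wᴴ * W) * diagonal (fun i => (v i : ℂ))) * Wᴴ := by
      simp only [Matrix.mul_assoc]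
    rw [e, hWW, Matrix.mul_one, diagonal_mul_diagonal]
    congr 3; funext i; push_cast; ring
  have hv0 : ∀ i, 0 ≤ v i := hH.eigenvalues_nonneg
  have hvpos : ∀ i, 0 < v i := by
    intro i
    refine lt_of_le_of_ne (hv0 i) fun h0 => ?_
    have hdet : (Xᴴ * X).det = 0 := by
      rw [hXX, det_mul, det_mul, det_diagonal, Finset.prod_eq_zero (Finset.mem_univ i), mul_zero,
        zero_mul]
      simp [← h0]
    rw [det_mul, det_conjTranspose] at hdet
    have h1 : X.det ≠ 0 := ((isUnit_iff_isUnit_det X).mp hX).ne_zero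
    rcases mul_eq_zero.mp hdet with h | h
    · exact h1 (star_eq_zero.mp h)
    · exact h1 h
  set σ : Equiv.Perm (Fin d) := Tuple.sort (fun i => -v i) with hσ
  have hanti : Antitone (fun i => v (σ i)) := fun i j hij => by
    have := Tuple.monotone_sort (fun i => -v i) hij
    simpa using this
  set U := W.submatrix id σ with hU
  set s : Fin d → ℝ := fun i => v (σ i) with hs
  have hspos : ∀ i, 0 < s i := fun i => hvpos _
  have hUU : Uᴴ * U = 1 := by
    rw [hU, conjTranspose_submatrix, ← submatrix_mul Wᴴ W σ id σ Function.bijective_id, hWW,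
      submatrix_one_equiv]
  have hXXU : Xᴴ * X = U * diagonal (fun i => ((s i ^ 2 : ℝ) : ℂ)) * Uᴴ := by
    have e : diagonal (fun i => ((s i ^ 2 : ℝ) : ℂ)) =
        (diagonal (fun i => ((v i ^ 2 : ℝ) : ℂ))).submatrix σ σ := by
      rw [submatrix_diagonal_equiv]; rfl
    rw [hXX, hU, e, conjTranspose_submatrix, ← submatrix_mul _ _ id σ σ σ.bijective,
      ← submatrix_mul _ _ id σ id σ.bijective, submatrix_id_id]
  have hD : Uᴴ * (Xᴴ * X) * U = diagonal (fun i => ((s i ^ 2 : ℝ) : ℂ)) := by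
    rw [hXXU]
    have e : Uᴴ * (U * diagonal (fun i => ((s i ^ 2 : ℝ) : ℂ)) * Uᴴ) * U =
      (Uᴴ * U) * diagonal (fun i => ((s i ^ 2 : ℝ) : ℂ)) * (Uᴴ * U) := by
      simp only [Matrix.mul_assoc]
    rw [e, hUU, Matrix.one_mul, Matrix.mul_one]
  set Di : Matrix (Fin d) (Fin d) ℂ := diagonal (fun i => (((s i)⁻¹ : ℝ) : ℂ)) with hDi
  have hDiH : Diᴴ = Di := by
    rw [hDi, diagonal_conjTranspose]; congr 1; funext i; simp
  refine ⟨U, X * U * Di, s, hUU, ?_, hspos, hanti, ?_, hXXU, ?_⟩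
  · have e : (X * U * Di)ᴴ * (X * U * Di) = Di * (Uᴴ * (Xᴴ * X) * U) * Di := by
      simp only [conjTranspose_mul, hDiH, Matrix.mul_assoc]
    rw [e, hD, hDi, diagonal_mul_diagonal, diagonal_mul_diagonal, ← diagonal_one]
    congr 1; funext i
    have := (hspos i).ne'
    rw [← Complex.ofReal_mul, ← Complex.ofReal_mul, ← Complex.ofReal_one]
    congr 1; field_simp
  · have e : (X * U * Di)ᴴ * X * U = Di * (Uᴴ * (Xᴴ * X) * U) := by
      simp only [conjTranspose_mul, hDiH, Matrix.mul_assoc]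
    rw [e, hD, hDi, diagonal_mul_diagonal]
    congr 1; funext i
    have := (hspos i).ne'
    rw [← Complex.ofReal_mul]
    congr 1; field_simp
  · intro q
    rw [hrpow q, trace_mul_cycle, hWW, Matrix.one_mul, trace_diagonal, Complex.re_sum]
    simp only [Complex.ofReal_re]
    exact (Equiv.sum_comp σ (fun i => v i ^ q)).symm

lemma norm_le_one_of_isometry {d : ℕ} {U : Matrix (Fin d) (Fin d) ℂ} (hU : Uᴴ * U = 1) :
    ‖U‖ ≤ 1 := by
  have h := CStarRing.norm_star_mul_self (x := U)
  rw [star_eq_conjTranspose, hU] at h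
  have h1 : ‖(1 : Matrix (Fin d) (Fin d) ℂ)‖ ≤ 1 := by
    rw [← diagonal_one, l2_opNorm_diagonal]
    exact (pi_norm_le_iff_of_nonneg zero_le_one).mpr fun i => by simp
  nlinarith [norm_nonneg U]

lemma norm_entry_le {d : ℕ} (M : Matrix (Fin d) (Fin d) ℂ) (i j : Fin d) : ‖M i j‖ ≤ ‖M‖ := by
  have h := l2_opNorm_mulVec M (EuclideanSpace.single j 1)
  rw [show ‖EuclideanSpace.single j (1 : ℂ)‖ = 1 by simp, mul_one] at h
  refine le_trans ?_ h
  refine le_trans (le_of_eq ?_) (PiLp.norm_apply_le _ i)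
  simp [EuclideanSpace.equiv]

/-! ### Majorization -/

/-- Abel summation: a nonnegative decreasing sequence is a nonnegative combination of indicators of
initial segments. -/
lemma exists_nonneg_sum_Ici_eq {d : ℕ} {c : Fin d → ℝ} (hc : Antitone c) (h0 : ∀ i, 0 ≤ c i) :
    ∃ a : Fin d → ℝ, (∀ k, 0 ≤ a k) ∧
      ∀ v : Fin d → ℝ, ∑ i, c i * v i = ∑ k, a k * ∑ i ∈ Finset.Iic k, v i := by
  set C : ℕ → ℝ := fun k => if h : k < d then c ⟨k, h⟩ else 0 with hC
  have hCi : ∀ i : Fin d, C i = c i := fun i => by simp [hC]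
  refine ⟨fun k => C k - C (k + 1), fun k => ?_, fun v => ?_⟩
  · change 0 ≤ C k - C (k + 1)
    rw [hCi]
    simp only [hC]
    split_ifs with h
    · exact sub_nonneg.mpr (hc (Fin.le_def.mpr (by simp)))
    · simpa using h0 k
  · have key : ∀ i : Fin d, c i = ∑ k ∈ Finset.Ici i, (C k - C (k + 1)) := by
      intro i
      have h1 : ∑ k ∈ Finset.Ici i, (C (k : ℕ) - C (k + 1)) =
          ∑ k ∈ Finset.Ico (i : ℕ) d, (C k - C (k + 1)) := by
        rw [← Fin.map_valEmbedding_Ici, Finset.sum_map]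
        rfl
      rw [h1, Finset.sum_Ico_eq_sub _ i.2.le, Finset.sum_range_sub', Finset.sum_range_sub', ← hCi]
      have : C d = 0 := by simp [hC]
      rw [this]; ring
    simp_rw [key, Finset.sum_mul, Finset.mul_sum]
    rw [Finset.sum_comm' (t' := Finset.univ) (s' := fun k => Finset.Iic k)]
    · intro i k; simp

/-- The supporting hyperplane of the convex function `y ↦ log ∑ exp (q y_i)` at `x`. -/
lemma log_sum_exp_ge {d : ℕ} [NeZero d] (q : ℝ) (x y : Fin d → ℝ) :
    Real.log (∑ i, Real.exp (q * x i)) +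
      q * ∑ i, Real.exp (q * x i) / (∑ j, Real.exp (q * x j)) * (y i - x i) ≤
      Real.log (∑ i, Real.exp (q * y i)) := by
  set Z := ∑ j, Real.exp (q * x j) with hZ
  have hne : (Finset.univ : Finset (Fin d)).Nonempty := Finset.univ_nonempty
  have hZ0 : 0 < Z := Finset.sum_pos (fun i _ => Real.exp_pos _) hne
  have h := Real.geom_mean_le_arith_mean_weighted Finset.univ
    (fun i => Real.exp (q * x i) / Z) (fun i => Real.exp (q * (y i - x i)))
    (fun i _ => by positivity) (by rw [← Finset.sum_div, ← hZ, div_self hZ0.ne'])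
    (fun i _ => (Real.exp_pos _).le)
  have h1 : ∑ i, Real.exp (q * x i) / Z * Real.exp (q * (y i - x i)) =
      (∑ i, Real.exp (q * y i)) / Z := by
    rw [Finset.sum_div]
    refine Finset.sum_congr rfl fun i _ => ?_
    rw [div_mul_eq_mul_div, ← Real.exp_add]
    congr 2; ring
  have h2 : ∏ i, Real.exp (q * (y i - x i)) ^ (Real.exp (q * x i) / Z) =
      Real.exp (q * ∑ i, Real.exp (q * x i) / Z * (y i - x i)) := by
    rw [Finset.mul_sum, Real.exp_sum]
    refine Finset.prod_congr rfl fun i _ => ?_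
    rw [← Real.exp_mul]
    congr 1; ring
  rw [h1, h2, le_div_iff₀ hZ0] at h
  have h3 := Real.log_le_log (by positivity) h
  rw [Real.log_mul (Real.exp_pos _).ne' hZ0.ne', Real.log_exp] at h3
  linarith

/-! ### Stein interpolation for Schatten quantities -/

/-- The product of the `k` largest singular values bounds the `k × k` minors in orthonormal
bases. -/
lemma norm_det_minor_le {d : ℕ} {X U₀ : Matrix (Fin d) (Fin d) ℂ} {s : Fin d → ℝ}
    (hs : ∀ i, 0 < s i) (hanti : Antitone s) (hU₀ : U₀ᴴ * U₀ = 1)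
    (hX : Xᴴ * X = U₀ * diagonal (fun i => ((s i ^ 2 : ℝ) : ℂ)) * U₀ᴴ) (k : Fin d)
    {U V : Matrix (Fin d) (Finset.Iic k) ℂ} (hU : Uᴴ * U = 1) (hV : Vᴴ * V = 1) :
    ‖(Vᴴ * X * U).det‖ ≤ ∏ i ∈ Finset.Iic k, s i := by
  have hk : 0 < s k ^ 2 := pow_pos (hs k) 2
  -- With the threshold `l = s k ^ 2`, exactly the factors with `i ≤ k` contribute.
  have h := norm_det_compression_sq_le (fun i => (pow_pos (hs i) 2).le) hU₀ hX hU hV hk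
  have h2 : ∏ i, max (s i ^ 2 / s k ^ 2) 1 = ∏ i ∈ Finset.Iic k, s i ^ 2 / s k ^ 2 := by
    rw [← Finset.prod_subset (Finset.subset_univ (Finset.Iic k))]
    · refine Finset.prod_congr rfl fun i hi => max_eq_left ?_
      rw [one_le_div hk]
      exact pow_le_pow_left₀ (hs k).le (hanti (Finset.mem_Iic.mp hi)) 2
    · intro i _ hi
      refine max_eq_right ?_
      rw [div_le_one hk]
      exact pow_le_pow_left₀ (hs i).le (hanti (le_of_lt (by simpa using hi))) 2
  rw [h2, Finset.prod_div_distrib, Finset.prod_const, Fintype.card_coe,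
    mul_div_cancel₀ _ (pow_pos hk _).ne', Finset.prod_pow] at h
  exact le_of_sq_le_sq h (Finset.prod_nonneg fun i _ => (hs i).le)

lemma submatrix_isometry {d : ℕ} {U : Matrix (Fin d) (Fin d) ℂ} (hU : Uᴴ * U = 1) (k : Fin d) :
    (U.submatrix id ((↑) : Finset.Iic k → Fin d))ᴴ *
      U.submatrix id ((↑) : Finset.Iic k → Fin d) = 1 := by
  rw [conjTranspose_submatrix, ← submatrix_mul Uᴴ U _ id _ Function.bijective_id, hU,
    submatrix_one _ Subtype.val_injective]

lemma differentiable_det_compression {d : ℕ} {m : Type*} [Fintype m] [DecidableEq m]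
    {F : ℂ → Matrix (Fin d) (Fin d) ℂ} (hF : ∀ i j, Differentiable ℂ fun z => F z i j)
    (U V : Matrix (Fin d) m ℂ) : Differentiable ℂ fun z => (Vᴴ * F z * U).det := by
  simp only [det_apply, Matrix.mul_apply, Finset.sum_mul]
  fun_prop

lemma norm_conjTranspose_mul_mul_le {d : ℕ} (X : Matrix (Fin d) (Fin d) ℂ)
    {U V : Matrix (Fin d) (Fin d) ℂ} (hU : Uᴴ * U = 1) (hV : Vᴴ * V = 1) :
    ‖Vᴴ * X * U‖ ≤ ‖X‖ := by
  refine (norm_mul_le _ _).trans ?_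
  have h2 := norm_mul_le Vᴴ X
  have h3 : ‖Vᴴ‖ ≤ 1 := by
    rw [← star_eq_conjTranspose, norm_star]; exact norm_le_one_of_isometry hV
  have h4 := norm_le_one_of_isometry hU
  nlinarith [norm_nonneg X, norm_nonneg U, norm_nonneg Vᴴ, norm_nonneg (Vᴴ * X)]

lemma norm_singular_le {d : ℕ} {X U V : Matrix (Fin d) (Fin d) ℂ} {s : Fin d → ℝ}
    (hs : ∀ i, 0 < s i) (hU : Uᴴ * U = 1) (hV : Vᴴ * V = 1)
    (h : Vᴴ * X * U = diagonal (fun i => (s i : ℂ))) (i : Fin d) : s i ≤ ‖X‖ := by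
  have h1 := norm_entry_le (Vᴴ * X * U) i i
  rw [h, diagonal_apply_eq, Complex.norm_real, Real.norm_of_nonneg (hs i).le, ← h] at h1
  exact h1.trans (norm_conjTranspose_mul_mul_le X hU hV)

/-- The reciprocals of the singular values are bounded by the norm of the inverse. -/
lemma one_le_norm_mul_singular {d : ℕ} {X G U V : Matrix (Fin d) (Fin d) ℂ} {s : Fin d → ℝ}
    (hs : ∀ i, 0 < s i) (hU : Uᴴ * U = 1) (hV : Vᴴ * V = 1)
    (h : Vᴴ * X * U = diagonal (fun i => (s i : ℂ))) (hG : G * X = 1) (i : Fin d) :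
    1 ≤ ‖G‖ * s i := by
  have hV' : V * Vᴴ = 1 := mul_eq_one_comm.mp hV
  have h1 : (Uᴴ * G * V) * (Vᴴ * X * U) = 1 := by
    have e : (Uᴴ * G * V) * (Vᴴ * X * U) = Uᴴ * (G * (V * Vᴴ) * X) * U := by
      simp only [Matrix.mul_assoc]
    rw [e, hV', Matrix.mul_one, hG, Matrix.mul_one, hU]
  rw [h] at h1
  have h2 := congrFun (congrFun h1 i) i
  rw [mul_diagonal, one_apply_eq] at h2
  have h3 := norm_entry_le (Uᴴ * G * V) i i
  have h4 := norm_conjTranspose_mul_mul_le G hV hU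
  have h5 : ‖(Uᴴ * G * V) i i‖ * s i = 1 := by
    rw [← Real.norm_of_nonneg (hs i).le, ← Complex.norm_real, ← norm_mul, h2, norm_one]
  rw [← h5]
  exact mul_le_mul_of_nonneg_right (h3.trans h4) (hs i).le

lemma continuous_abs_rpow {d : ℕ} {q : ℝ} (hq : 0 < q) :
    Continuous fun X : Matrix (Fin d) (Fin d) ℂ => CFC.abs X ^ q := by
  have h1 : ContinuousOn (fun a : Matrix (Fin d) (Fin d) ℂ => a ^ q.toNNReal) {a | 0 ≤ a} :=
    CFC.continuousOn_nnrpow _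
  have h2 : Continuous fun X : Matrix (Fin d) (Fin d) ℂ => CFC.abs X ^ q.toNNReal :=
    h1.comp_continuous CFC.continuous_abs fun X => CFC.abs_nonneg X
  refine h2.congr fun X => ?_
  rw [CFC.nnrpow_eq_rpow (Real.toNNReal_pos.mpr hq), Real.coe_toNNReal q hq.le]

lemma continuous_schattenNorm {d : ℕ} {p : ℝ≥0∞} (hp : 0 < p) :
    Continuous fun X : Matrix (Fin d) (Fin d) ℂ => schattenNorm p X := by
  unfold schattenNorm
  split_ifs with h
  · exact continuous_norm
  · have hp' : 0 < p.toReal := ENNReal.toReal_pos hp.ne' h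
    have h1 : Continuous fun X : Matrix (Fin d) (Fin d) ℂ =>
        (trace (CFC.abs X ^ p.toReal)).re :=
      Complex.continuous_re.comp ((continuous_abs_rpow hp').matrix_trace)
    exact h1.rpow_const fun X => Or.inr (by positivity)

lemma integrable_hirschmanMeasure_of_bounded {θ : ℝ} (hθ : θ ∈ Set.Ioo (0 : ℝ) 1) {g : ℝ → ℝ}
    (hg : Continuous g) {C : ℝ} (hC : ∀ t, |g t| ≤ C) : Integrable g (hirschmanMeasure θ) := by
  have := isProbabilityMeasure_hirschmanMeasure hθ
  exact Integrable.of_bound hg.aestronglyMeasurable C (.of_forall hC)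

/-- A holomorphic matrix family to which interpolation on the strip `0 ≤ Re z ≤ 1` applies: it is
bounded on the strip, unitary on the line `Re z = 0`, and boundedly invertible on `Re z = 1`. -/
structure IsStripFamily {d : ℕ} (F : ℂ → Matrix (Fin d) (Fin d) ℂ) : Prop where
  differentiable : ∀ i j, Differentiable ℂ fun z => F z i j
  bounded : ∃ C, ∀ z : ℂ, 0 ≤ z.re → z.re ≤ 1 → ‖F z‖ ≤ C
  isometry : ∀ t : ℝ, (F (t * Complex.I))ᴴ * F (t * Complex.I) = 1
  isUnit : ∀ z, IsUnit (F z)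
  inverse : ∃ C, ∀ t : ℝ, ∃ G, G * F (1 + t * Complex.I) = 1 ∧ ‖G‖ ≤ C

namespace IsStripFamily

variable {d : ℕ} {F : ℂ → Matrix (Fin d) (Fin d) ℂ}

lemma continuous (hF : IsStripFamily F) : Continuous F :=
  continuous_matrix fun i j => (hF.differentiable i j).continuous

lemma continuous_line (hF : IsStripFamily F) : Continuous fun t : ℝ => F (1 + t * Complex.I) :=
  hF.continuous.comp (by fun_prop)

/-- Every compression determinant is a scalar function to which the three lines theorem applies. -/
lemma log_norm_det_le (hF : IsStripFamily F) {m : Type*} [Fintype m] [DecidableEq m]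
    {U V : Matrix (Fin d) m ℂ} (hU : Uᴴ * U = 1) (hV : Vᴴ * V = 1) {θ δ : ℝ}
    (hθ : θ ∈ Set.Ioo (0 : ℝ) 1) (hδ : 0 < δ) (hδ1 : δ ≤ 1) (hne : (Vᴴ * F θ * U).det ≠ 0) :
    Integrable (fun t : ℝ => Real.log (max ‖(Vᴴ * F (1 + t * Complex.I) * U).det‖ δ))
      (hirschmanMeasure θ) ∧
    Real.log ‖(Vᴴ * F θ * U).det‖ ≤ θ * ∫ t : ℝ,
      Real.log (max ‖(Vᴴ * F (1 + t * Complex.I) * U).det‖ δ) ∂(hirschmanMeasure θ) := by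
  obtain ⟨C, hC⟩ := hF.bounded
  have hcont : Continuous fun X : Matrix (Fin d) (Fin d) ℂ => (Vᴴ * X * U).det := by fun_prop
  obtain ⟨K, hK⟩ :=
    (isCompact_closedBall (0 : Matrix (Fin d) (Fin d) ℂ) C).exists_bound_of_continuousOn
    hcont.continuousOn
  have hK' : ∀ z : ℂ, 0 ≤ z.re → z.re ≤ 1 → ‖(Vᴴ * F z * U).det‖ ≤ K := fun z h1 h2 =>
    hK _ (by simpa using hC z h1 h2)
  have hdiff := differentiable_det_compression hF.differentiable U V
  refine ⟨?_, log_norm_le_integral_strip hdiff hK' ?_ hθ hne hδ hδ1⟩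
  · refine integrable_hirschmanMeasure_of_bounded hθ
      (C := |Real.log δ| + |Real.log (max K δ)|) ?_ fun t => ?_
    · refine Continuous.log ?_ fun t => (lt_of_lt_of_le hδ (le_max_right _ _)).ne'
      exact (hcont.comp hF.continuous_line).norm.max continuous_const
    · have h1 : Real.log δ ≤ Real.log (max ‖(Vᴴ * F (1 + t * Complex.I) * U).det‖ δ) :=
        Real.log_le_log hδ (le_max_right _ _)
      have h2 : Real.log (max ‖(Vᴴ * F (1 + t * Complex.I) * U).det‖ δ) ≤ Real.log (max K δ) :=
        Real.log_le_log (lt_of_lt_of_le hδ (le_max_right _ _))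
          (max_le_max_right δ (hK' _ (by simp) (by simp)))
      rw [abs_le]
      constructor
      · linarith [neg_abs_le (Real.log δ), abs_nonneg (Real.log (max K δ))]
      · linarith [le_abs_self (Real.log (max K δ)), abs_nonneg (Real.log δ)]
  · intro t
    have h := norm_det_compression_sq_le (X := F (t * Complex.I)) (W := 1) (a := fun _ => 1)
      (fun _ => zero_le_one) (by simp) (by simp [hF.isometry t]) hU hV one_pos
    simp only [one_pow, div_one, max_self, Finset.prod_const_one, mul_one] at h
    exact (sq_le_one_iff₀ (norm_nonneg _)).mp h

/-- Log-majorization by interpolation, `0 < q < ∞`. The minors of `F` in the singular bases of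
`F θ` are interpolated, and the resulting weak majorization is combined with the convexity of
log-sum-exp. -/
theorem log_trace_le [NeZero d] (hF : IsStripFamily F) {θ q : ℝ} (hθ : θ ∈ Set.Ioo (0 : ℝ) 1)
    (hq : 0 < q) :
    Integrable (fun t : ℝ => Real.log (trace (CFC.abs (F (1 + t * Complex.I)) ^ q)).re)
      (hirschmanMeasure θ) ∧
    0 < (trace (CFC.abs (F θ) ^ (q / θ))).re ∧
    Real.log (trace (CFC.abs (F θ) ^ (q / θ))).re ≤
      ∫ t : ℝ, Real.log (trace (CFC.abs (F (1 + t * Complex.I)) ^ q)).re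
        ∂(hirschmanMeasure θ) := by
  have hprob := isProbabilityMeasure_hirschmanMeasure hθ
  have hθ0 := hθ.1
  have hne : (Finset.univ : Finset (Fin d)).Nonempty := Finset.univ_nonempty
  obtain ⟨C, hC⟩ := hF.bounded
  obtain ⟨C', hC'⟩ := hF.inverse
  -- Uniform bounds `η ≤ s_i (F (1 + it)) ≤ K`.
  set K := max C 1 with hK
  set η := (max C' 1)⁻¹ with hη
  have hη0 : 0 < η := by positivity
  have hη1 : η ≤ 1 := inv_le_one_of_one_le₀ (le_max_right _ _)
  have hsv : ∀ t : ℝ, ∃ s : Fin d → ℝ, (∀ i, η ≤ s i) ∧ (∀ i, s i ≤ K) ∧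
      (∀ k : Fin d, ∀ U V : Matrix (Fin d) (Finset.Iic k) ℂ, Uᴴ * U = 1 → Vᴴ * V = 1 →
        ‖(Vᴴ * F (1 + t * Complex.I) * U).det‖ ≤ ∏ i ∈ Finset.Iic k, s i) ∧
      (trace (CFC.abs (F (1 + t * Complex.I)) ^ q)).re = ∑ i, s i ^ q := by
    intro t
    obtain ⟨U, V, s, hU, hV, hs, hanti, hVXU, hXX, htr⟩ :=
      exists_sorted_svd (hF.isUnit (1 + t * Complex.I))
    obtain ⟨G, hG, hGC⟩ := hC' t
    refine ⟨s, fun i => ?_, fun i => ?_, fun k U' V' hU' hV' =>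
      norm_det_minor_le hs hanti hU hXX k hU' hV', htr q⟩
    · have h1 := one_le_norm_mul_singular hs hU hV hVXU hG i
      rw [hη, inv_le_iff_one_le_mul₀' (by positivity)]
      exact h1.trans (mul_le_mul_of_nonneg_right (hGC.trans (le_max_left _ _)) (hs i).le)
    · exact (norm_singular_le hs hU hV hVXU i).trans
        ((hC _ (by simp) (by simp)).trans (le_max_left _ _))
  have hcont : Continuous fun t : ℝ => (trace (CFC.abs (F (1 + t * Complex.I)) ^ q)).re :=
    Complex.continuous_re.comp
      (((continuous_abs_rpow hq).comp hF.continuous_line).matrix_trace)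
  have hd : (0 : ℝ) < d := by exact_mod_cast Nat.pos_of_ne_zero (NeZero.ne d)
  have hlow : ∀ t : ℝ, d * η ^ q ≤ (trace (CFC.abs (F (1 + t * Complex.I)) ^ q)).re := by
    intro t
    obtain ⟨s, h1, h2, h3, h4⟩ := hsv t
    rw [h4]
    calc d * η ^ q = ∑ _i : Fin d, η ^ q := by simp
      _ ≤ _ := Finset.sum_le_sum fun i _ => Real.rpow_le_rpow hη0.le (h1 i) hq.le
  have hup : ∀ t : ℝ, (trace (CFC.abs (F (1 + t * Complex.I)) ^ q)).re ≤ d * K ^ q := by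
    intro t
    obtain ⟨s, h1, h2, h3, h4⟩ := hsv t
    rw [h4]
    calc _ ≤ ∑ _i : Fin d, K ^ q := Finset.sum_le_sum fun i _ =>
          Real.rpow_le_rpow (hη0.le.trans (h1 i)) (h2 i) hq.le
      _ = _ := by simp
  have hlow0 : 0 < d * η ^ q := by positivity
  have hint : Integrable (fun t : ℝ => Real.log (trace (CFC.abs (F (1 + t * Complex.I)) ^ q)).re)
      (hirschmanMeasure θ) := by
    refine integrable_hirschmanMeasure_of_bounded hθ
      (C := |Real.log (d * η ^ q)| + |Real.log (d * K ^ q)|)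
      (hcont.log fun t => (hlow0.trans_le (hlow t)).ne') fun t => ?_
    have h1 := Real.log_le_log hlow0 (hlow t)
    have h2 := Real.log_le_log (hlow0.trans_le (hlow t)) (hup t)
    rw [abs_le]
    constructor
    · linarith [neg_abs_le (Real.log (d * η ^ q)), abs_nonneg (Real.log (d * K ^ q))]
    · linarith [le_abs_self (Real.log (d * K ^ q)), abs_nonneg (Real.log (d * η ^ q))]
  obtain ⟨U, V, s, hU, hV, hs, hanti, hVXU, hXX, htr⟩ := exists_sorted_svd (hF.isUnit θ)
  set x : Fin d → ℝ := fun i => Real.log (s i) / θ with hx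
  have hexp : ∀ i, Real.exp (q * x i) = s i ^ (q / θ) := fun i => by
    rw [Real.rpow_def_of_pos (hs i), hx]; congr 1; field_simp
  have hZ : (trace (CFC.abs (F θ) ^ (q / θ))).re = ∑ i, Real.exp (q * x i) := by
    rw [htr]; exact Finset.sum_congr rfl fun i _ => (hexp i).symm
  set Z := ∑ i, Real.exp (q * x i) with hZdef
  have hZ0 : 0 < Z := Finset.sum_pos (fun i _ => Real.exp_pos _) hne
  rw [hZ]
  refine ⟨hint, hZ0, ?_⟩
  -- The gradient of `(1 / q) log ∑ exp (q y_i)` at `y = x`.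
  set c : Fin d → ℝ := fun i => Real.exp (q * x i) / Z with hc
  have hcanti : Antitone c := fun i j hij => by
    simp only [hc, hexp]
    exact div_le_div_of_nonneg_right
      (Real.rpow_le_rpow (hs j).le (hanti hij) (by positivity)) hZ0.le
  obtain ⟨a, ha0, ha⟩ := exists_nonneg_sum_Ici_eq hcanti (fun i => by positivity)
  set U' : (k : Fin d) → Matrix (Fin d) (Finset.Iic k) ℂ := fun k => U.submatrix id (↑) with hU'
  set V' : (k : Fin d) → Matrix (Fin d) (Finset.Iic k) ℂ := fun k => V.submatrix id (↑) with hV'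
  have hU1 : ∀ k, (U' k)ᴴ * U' k = 1 := submatrix_isometry hU
  have hV1 : ∀ k, (V' k)ᴴ * V' k = 1 := submatrix_isometry hV
  have hminor : ∀ k, ((V' k)ᴴ * F θ * U' k).det = ((∏ i ∈ Finset.Iic k, s i : ℝ) : ℂ) := by
    intro k
    have e : (V' k)ᴴ * F θ * U' k = diagonal fun i : Finset.Iic k => ((s i : ℝ) : ℂ) := by
      have e1 : (V' k)ᴴ * F θ * U' k =
          (Vᴴ * F θ * U).submatrix ((↑) : Finset.Iic k → Fin d) (↑) := by
        ext i j; simp [hU', hV', Matrix.mul_apply]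
      rw [e1, hVXU, submatrix_diagonal _ _ Subtype.val_injective]; rfl
    rw [e, det_diagonal, Complex.ofReal_prod]
    exact Finset.prod_coe_sort (Finset.Iic k) fun i => ((s i : ℝ) : ℂ)
  have hprodpos : ∀ k : Fin d, 0 < ∏ i ∈ Finset.Iic k, s i := fun k =>
    Finset.prod_pos fun i _ => hs i
  -- A lower bound for all products of the `k` largest singular values of `F (1 + it)`.
  set δ := η ^ d with hδ
  have hδ0 : 0 < δ := pow_pos hη0 d
  have hδ1 : δ ≤ 1 := pow_le_one₀ hη0.le hη1
  set L : Fin d → ℝ → ℝ := fun k t =>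
    Real.log (max ‖((V' k)ᴴ * F (1 + t * Complex.I) * U' k).det‖ δ) with hL
  have hLint : ∀ k, Integrable (L k) (hirschmanMeasure θ) ∧
      ∑ i ∈ Finset.Iic k, x i ≤ ∫ t, L k t ∂(hirschmanMeasure θ) := by
    intro k
    have h := hF.log_norm_det_le (hU1 k) (hV1 k) hθ hδ0 hδ1
      (by rw [hminor]; exact_mod_cast (hprodpos k).ne')
    refine ⟨h.1, ?_⟩
    have h2 := h.2
    rw [hminor, Complex.norm_real, Real.norm_of_nonneg (hprodpos k).le,
      Real.log_prod (fun i _ => (hs i).ne')] at h2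
    rw [hx, ← Finset.sum_div, div_le_iff₀' hθ0]
    exact h2
  have hpt : ∀ t : ℝ, Real.log Z + q * (∑ k, a k * L k t - ∑ i, c i * x i) ≤
      Real.log (trace (CFC.abs (F (1 + t * Complex.I)) ^ q)).re := by
    intro t
    obtain ⟨σ, h1, h2, h3, h4⟩ := hsv t
    have hσ : ∀ i, 0 < σ i := fun i => hη0.trans_le (h1 i)
    have h5 := log_sum_exp_ge q x (fun i => Real.log (σ i))
    have h6 : ∑ i, Real.exp (q * Real.log (σ i)) = ∑ i, σ i ^ q :=
      Finset.sum_congr rfl fun i _ => by rw [Real.rpow_def_of_pos (hσ i), mul_comm]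
    rw [h6, ← h4] at h5
    refine le_trans ?_ h5
    have h7 : ∑ i, Real.exp (q * x i) / Z * (Real.log (σ i) - x i) =
        ∑ k, a k * ∑ i ∈ Finset.Iic k, Real.log (σ i) - ∑ i, c i * x i := by
      rw [← ha, ← Finset.sum_sub_distrib]
      exact Finset.sum_congr rfl fun i _ => by rw [mul_sub]
    rw [← hZdef, h7]
    have h8 : ∀ k, L k t ≤ ∑ i ∈ Finset.Iic k, Real.log (σ i) := by
      intro k
      rw [← Real.log_prod (fun i _ => (hσ i).ne')]
      refine Real.log_le_log (lt_of_lt_of_le hδ0 (le_max_right _ _))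
        (max_le (h3 k _ _ (hU1 k) (hV1 k)) ?_)
      calc δ ≤ η ^ (Finset.Iic k).card :=
            pow_le_pow_of_le_one hη0.le hη1 ((Finset.card_le_univ _).trans_eq (Fintype.card_fin d))
        _ = ∏ _i ∈ Finset.Iic k, η := by rw [Finset.prod_const]
        _ ≤ _ := Finset.prod_le_prod (fun _ _ => hη0.le) fun i _ => h1 i
    gcongr with k
    · exact ha0 k
    · exact h8 k
  have hsumint : Integrable (fun t => ∑ k, a k * L k t) (hirschmanMeasure θ) :=
    integrable_finsetSum _ fun k _ => (hLint k).1.const_mul _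
  have hdiff : Integrable (fun t => q * (∑ k, a k * L k t - ∑ i, c i * x i))
      (hirschmanMeasure θ) := (hsumint.sub (integrable_const _)).const_mul q
  have hI := integral_mono ((integrable_const (Real.log Z)).add hdiff) hint hpt
  have hcalc : ∫ t, (Real.log Z + q * (∑ k, a k * L k t - ∑ i, c i * x i)) ∂(hirschmanMeasure θ) =
      Real.log Z + q * (∑ k, a k * ∫ t, L k t ∂(hirschmanMeasure θ) - ∑ i, c i * x i) := by
    rw [integral_add (integrable_const _) hdiff, integral_const_mul,
      integral_sub hsumint (integrable_const _),
      integral_finsetSum _ (fun k _ => (hLint k).1.const_mul _)]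
    simp only [integral_const_mul, integral_const, probReal_univ, one_smul]
  change ∫ t, (Real.log Z + q * (∑ k, a k * L k t - ∑ i, c i * x i)) ∂(hirschmanMeasure θ) ≤ _
    at hI
  rw [hcalc] at hI
  have h9 : ∑ i, c i * x i ≤ ∑ k, a k * ∫ t, L k t ∂(hirschmanMeasure θ) := by
    rw [ha]
    exact Finset.sum_le_sum fun k _ => mul_le_mul_of_nonneg_left (hLint k).2 (ha0 k)
  nlinarith

/-- The case `q = ∞` of interpolation: only the largest singular value is involved. -/
theorem log_norm_le [NeZero d] (hF : IsStripFamily F) {θ : ℝ} (hθ : θ ∈ Set.Ioo (0 : ℝ) 1) :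
    Integrable (fun t : ℝ => Real.log ‖F (1 + t * Complex.I)‖) (hirschmanMeasure θ) ∧
    0 < ‖F θ‖ ∧
    Real.log ‖F θ‖ ≤ θ * ∫ t : ℝ, Real.log ‖F (1 + t * Complex.I)‖ ∂(hirschmanMeasure θ) := by
  have hprob := isProbabilityMeasure_hirschmanMeasure hθ
  have hθ0 := hθ.1
  obtain ⟨C, hC⟩ := hF.bounded
  obtain ⟨C', hC'⟩ := hF.inverse
  set δ := (max C' 1)⁻¹ with hδ
  have hδ0 : 0 < δ := by positivity
  have hδ1 : δ ≤ 1 := inv_le_one_of_one_le₀ (le_max_right _ _)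
  have hlow : ∀ t : ℝ, δ ≤ ‖F (1 + t * Complex.I)‖ := by
    intro t
    obtain ⟨U, V, s, hU, hV, hs, -, hVXU, -⟩ := exists_sorted_svd (hF.isUnit (1 + t * Complex.I))
    obtain ⟨G, hG, hGC⟩ := hC' t
    refine le_trans ?_ (norm_singular_le hs hU hV hVXU 0)
    rw [hδ, inv_le_iff_one_le_mul₀' (by positivity)]
    exact (one_le_norm_mul_singular hs hU hV hVXU hG 0).trans
      (mul_le_mul_of_nonneg_right (hGC.trans (le_max_left _ _)) (hs 0).le)
  have hup : ∀ t : ℝ, ‖F (1 + t * Complex.I)‖ ≤ max C 1 := fun t =>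
    (hC _ (by simp) (by simp)).trans (le_max_left _ _)
  have hint : Integrable (fun t : ℝ => Real.log ‖F (1 + t * Complex.I)‖) (hirschmanMeasure θ) := by
    refine integrable_hirschmanMeasure_of_bounded hθ (C := |Real.log δ| + |Real.log (max C 1)|)
      (hF.continuous_line.norm.log fun t => (hδ0.trans_le (hlow t)).ne') fun t => ?_
    have h1 := Real.log_le_log hδ0 (hlow t)
    have h2 := Real.log_le_log (hδ0.trans_le (hlow t)) (hup t)
    rw [abs_le]
    constructor
    · linarith [neg_abs_le (Real.log δ), abs_nonneg (Real.log (max C 1))]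
    · linarith [le_abs_self (Real.log (max C 1)), abs_nonneg (Real.log δ)]
  obtain ⟨U, V, s, hU, hV, hs, hanti, hVXU, -⟩ := exists_sorted_svd (hF.isUnit θ)
  have hnorm : ‖F θ‖ = s 0 := by
    refine le_antisymm ?_ (norm_singular_le hs hU hV hVXU 0)
    have hU' : U * Uᴴ = 1 := mul_eq_one_comm.mp hU
    have hV' : V * Vᴴ = 1 := mul_eq_one_comm.mp hV
    have e : F θ = Vᴴᴴ * diagonal (fun i => (s i : ℂ)) * Uᴴ := by
      rw [← hVXU, conjTranspose_conjTranspose]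
      have : V * (Vᴴ * F θ * U) * Uᴴ = (V * Vᴴ) * F θ * (U * Uᴴ) := by
        simp only [Matrix.mul_assoc]
      rw [this, hU', hV', Matrix.one_mul, Matrix.mul_one]
    rw [e]
    refine (norm_conjTranspose_mul_mul_le _ (by rwa [conjTranspose_conjTranspose])
      (by rwa [conjTranspose_conjTranspose])).trans ?_
    rw [l2_opNorm_diagonal]
    refine (pi_norm_le_iff_of_nonneg (hs 0).le).mpr fun i => ?_
    rw [Complex.norm_real, Real.norm_of_nonneg (hs i).le]
    exact hanti (Fin.zero_le i)
  have hpos : 0 < ‖F θ‖ := hnorm ▸ hs 0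
  refine ⟨hint, hpos, ?_⟩
  have hdet : ∀ X : Matrix (Fin d) (Fin d) ℂ,
      ((V.submatrix id fun _ : Fin 1 => (0 : Fin d))ᴴ * X *
        U.submatrix id fun _ : Fin 1 => (0 : Fin d)).det = (Vᴴ * X * U) 0 0 := by
    intro X
    rw [det_fin_one]; simp [Matrix.mul_apply]
  have hiso : ∀ U : Matrix (Fin d) (Fin d) ℂ, Uᴴ * U = 1 →
      (U.submatrix id fun _ : Fin 1 => (0 : Fin d))ᴴ *
        U.submatrix id (fun _ : Fin 1 => (0 : Fin d)) = 1 := by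
    intro U hU
    rw [conjTranspose_submatrix, ← submatrix_mul Uᴴ U _ id _ Function.bijective_id, hU,
      submatrix_one _ (Function.injective_of_subsingleton _)]
  have hθdet : (Vᴴ * F θ * U) 0 0 = (s 0 : ℂ) := by rw [hVXU, diagonal_apply_eq]
  have h := hF.log_norm_det_le (hiso U hU) (hiso V hV) hθ hδ0 hδ1
    (by rw [hdet, hθdet]; exact_mod_cast (hs 0).ne')
  simp only [hdet, hθdet] at h
  rw [Complex.norm_real, Real.norm_of_nonneg (hs 0).le, ← hnorm] at h
  refine h.2.trans (mul_le_mul_of_nonneg_left (integral_mono h.1 hint fun t => ?_) hθ0.le)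
  exact Real.log_le_log (lt_of_lt_of_le hδ0 (le_max_right _ _))
    (max_le ((norm_entry_le _ 0 0).trans (norm_conjTranspose_mul_mul_le _ hU hV)) (hlow t))

end IsStripFamily

/-! ### Complex powers of positive matrices -/

lemma Matrix.IsHermitian.cfc_complex_eq {d : ℕ} {A : Matrix (Fin d) (Fin d) ℂ} (hA : A.IsHermitian)
    (f : ℂ → ℂ) : cfc f A = (hA.eigenvectorUnitary : Matrix (Fin d) (Fin d) ℂ) *
      diagonal (fun i => f (hA.eigenvalues i)) *
      (hA.eigenvectorUnitary : Matrix (Fin d) (Fin d) ℂ)ᴴ := by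
  have hcont : ∀ g : ℂ → ℂ, ContinuousOn g (spectrum ℂ A) := fun g =>
    (Matrix.finite_spectrum A).continuousOn g
  have hre : ∀ g : ℝ → ℝ, cfc (fun z : ℂ => (g z.re : ℂ)) A =
      (hA.eigenvectorUnitary : Matrix (Fin d) (Fin d) ℂ) *
      diagonal (fun i => (g (hA.eigenvalues i) : ℂ)) *
      (hA.eigenvectorUnitary : Matrix (Fin d) (Fin d) ℂ)ᴴ := by
    intro g
    rw [← cfc_real_eq_complex g hA, hA.cfc_eq, Matrix.IsHermitian.cfc,
      Unitary.conjStarAlgAut_apply]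
    rfl
  have hcongr : cfc f A = cfc (fun z : ℂ => ((f (z.re : ℂ)).re : ℂ) +
      Complex.I * ((f (z.re : ℂ)).im : ℂ)) A := by
    refine cfc_congr fun z hz => ?_
    rw [hA.spectrum_eq_image_range] at hz
    obtain ⟨x, -, rfl⟩ := hz
    rw [mul_comm]
    exact (Complex.re_add_im (f x)).symm
  rw [hcongr, cfc_add (a := A) (hf := hcont _) (hg := hcont _),
    cfc_const_mul Complex.I (fun z : ℂ => ((f (z.re : ℂ)).im : ℂ)) A (hcont _),
    hre (fun x => (f x).re), hre (fun x => (f x).im),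
    ← Matrix.smul_mul, ← Matrix.mul_smul, ← Matrix.add_mul, ← Matrix.mul_add, ← diagonal_smul,
    diagonal_add]
  congr 3
  funext i
  simp only [Pi.smul_apply, smul_eq_mul]
  rw [mul_comm, Complex.re_add_im]

/-- A single diagonalization of `A` describes the powers of all the shifted matrices `A + ε`. -/
lemma exists_diagonalization {d : ℕ} {A : Matrix (Fin d) (Fin d) ℂ} (hA : A.PosSemidef) :
    ∃ (W : Matrix (Fin d) (Fin d) ℂ) (v : Fin d → ℝ), Wᴴ * W = 1 ∧ (∀ i, 0 ≤ v i) ∧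
      (∀ (ε : ℝ) (z : ℂ), matrixCpow (A + algebraMap ℂ _ (ε : ℂ)) z =
        W * diagonal (fun i => ((v i + ε : ℝ) : ℂ) ^ z) * Wᴴ) ∧
      ∀ r : ℝ, A ^ r = W * diagonal (fun i => ((v i ^ r : ℝ) : ℂ)) * Wᴴ := by
  have hcont : ∀ (g : ℂ → ℂ), ContinuousOn g (spectrum ℂ A) := fun g =>
    (Matrix.finite_spectrum A).continuousOn g
  have hnorm : IsStarNormal A := hA.1.isSelfAdjoint.isStarNormal
  refine ⟨hA.1.eigenvectorUnitary, hA.1.eigenvalues,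
    Unitary.coe_star_mul_self hA.1.eigenvectorUnitary, hA.eigenvalues_nonneg, fun ε z => ?_,
    hA.rpow_eq⟩
  have h1 : A + algebraMap ℂ _ (ε : ℂ) = cfc (fun w : ℂ => w + ε) A := by
    rw [cfc_add_const (ε : ℂ) (fun w => w) A (hcont _), cfc_id' ℂ A]
  unfold matrixCpow
  rw [h1, ← cfc_comp (a := A) (hf := hcont _)
    (hg := ((Matrix.finite_spectrum A).image _).continuousOn _), hA.1.cfc_complex_eq]
  simp

lemma conj_diagonal_mul {d : ℕ} {W : Matrix (Fin d) (Fin d) ℂ} (hW : Wᴴ * W = 1)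
    (f g : Fin d → ℂ) : W * diagonal f * Wᴴ * (W * diagonal g * Wᴴ) =
      W * diagonal (fun i => f i * g i) * Wᴴ := by
  have e : W * diagonal f * Wᴴ * (W * diagonal g * Wᴴ) =
      W * (diagonal f * (Wᴴ * W) * diagonal g) * Wᴴ := by simp only [Matrix.mul_assoc]
  rw [e, hW, Matrix.mul_one, diagonal_mul_diagonal]

lemma norm_conj_diagonal_le {d : ℕ} {W : Matrix (Fin d) (Fin d) ℂ} (hW : Wᴴ * W = 1)
    {f : Fin d → ℂ} {C : ℝ} (hC : 0 ≤ C) (hf : ∀ i, ‖f i‖ ≤ C) :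
    ‖W * diagonal f * Wᴴ‖ ≤ C := by
  have hW' : (Wᴴ)ᴴ * Wᴴ = 1 := by
    rw [conjTranspose_conjTranspose]; exact mul_eq_one_comm.mp hW
  have h := norm_conjTranspose_mul_mul_le (diagonal f) hW' hW'
  rw [conjTranspose_conjTranspose, l2_opNorm_diagonal] at h
  exact h.trans ((pi_norm_le_iff_of_nonneg hC).mpr hf)

lemma conj_diagonal_one {d : ℕ} {W : Matrix (Fin d) (Fin d) ℂ} (hW : Wᴴ * W = 1) :
    W * diagonal (fun _ => 1) * Wᴴ = 1 := by
  rw [diagonal_one, Matrix.mul_one]; exact mul_eq_one_comm.mp hW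

lemma continuous_conj_diagonal {d : ℕ} {X : Type*} [TopologicalSpace X]
    (W : Matrix (Fin d) (Fin d) ℂ) :
    Continuous fun f : Fin d → ℂ => W * diagonal f * Wᴴ := by
  fun_prop

lemma isStripFamily_one {d : ℕ} : IsStripFamily fun _ => (1 : Matrix (Fin d) (Fin d) ℂ) where
  differentiable _ _ := differentiable_const _
  bounded := ⟨_, fun _ _ _ => le_rfl⟩
  isometry _ := by simp
  isUnit _ := isUnit_one
  inverse := ⟨_, fun _ => ⟨1, by simp, le_rfl⟩⟩

lemma IsStripFamily.mul {d : ℕ} {F G : ℂ → Matrix (Fin d) (Fin d) ℂ} (hF : IsStripFamily F)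
    (hG : IsStripFamily G) : IsStripFamily fun z => F z * G z where
  differentiable i j := by
    have h1 := hF.differentiable
    have h2 := hG.differentiable
    simp only [Matrix.mul_apply]
    fun_prop
  bounded := by
    obtain ⟨C, hC⟩ := hF.bounded
    obtain ⟨D, hD⟩ := hG.bounded
    exact ⟨C * D, fun z h1 h2 => (norm_mul_le _ _).trans (mul_le_mul (hC z h1 h2) (hD z h1 h2)
      (norm_nonneg _) ((norm_nonneg _).trans (hC z h1 h2)))⟩
  isometry t := by
    rw [conjTranspose_mul, Matrix.mul_assoc, ← Matrix.mul_assoc (F (t * Complex.I))ᴴ, hF.isometry,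
      Matrix.one_mul, hG.isometry]
  isUnit z := (hF.isUnit z).mul (hG.isUnit z)
  inverse := by
    obtain ⟨C, hC⟩ := hF.inverse
    obtain ⟨D, hD⟩ := hG.inverse
    refine ⟨D * C, fun t => ?_⟩
    obtain ⟨S, hS, hSC⟩ := hC t
    obtain ⟨T, hT, hTD⟩ := hD t
    refine ⟨T * S, ?_, (norm_mul_le _ _).trans (mul_le_mul hTD hSC (norm_nonneg _)
      ((norm_nonneg _).trans hTD))⟩
    rw [Matrix.mul_assoc, ← Matrix.mul_assoc S, hS, Matrix.one_mul, hT]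

/-- Complex powers of the positive definite matrix `A + ε`. -/
lemma isStripFamily_matrixCpow {d : ℕ} {A : Matrix (Fin d) (Fin d) ℂ} (hA : A.PosSemidef)
    {ε : ℝ} (hε : 0 < ε) : IsStripFamily fun z => matrixCpow (A + algebraMap ℂ _ (ε : ℂ)) z := by
  obtain ⟨W, v, hW, hv, hpow, -⟩ := exists_diagonalization hA
  have hpos : ∀ i, 0 < v i + ε := fun i => by linarith [hv i]
  have hne : ∀ i, ((v i + ε : ℝ) : ℂ) ≠ 0 := fun i => by exact_mod_cast (hpos i).ne'
  simp only [hpow]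
  have hinv : ∀ z : ℂ, W * diagonal (fun i => ((v i + ε : ℝ) : ℂ) ^ (-z)) * Wᴴ *
      (W * diagonal (fun i => ((v i + ε : ℝ) : ℂ) ^ z) * Wᴴ) = 1 := by
    intro z
    rw [conj_diagonal_mul hW]
    have : (fun i => ((v i + ε : ℝ) : ℂ) ^ (-z) * ((v i + ε : ℝ) : ℂ) ^ z) = fun _ => 1 := by
      funext i
      rw [← Complex.cpow_add _ _ (hne i), neg_add_cancel, Complex.cpow_zero]
    rw [this, conj_diagonal_one hW]
  refine ⟨fun i j => ?_, ?_, fun t => ?_, fun z => ?_, ?_⟩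
  · have h1 : ∀ k, Differentiable ℂ fun z : ℂ => ((v k + ε : ℝ) : ℂ) ^ z := fun k =>
      differentiable_id.const_cpow (Or.inl (hne k))
    have h2 : ∀ z : ℂ, (W * diagonal (fun i => ((v i + ε : ℝ) : ℂ) ^ z) * Wᴴ) i j =
        ∑ k, W i k * ((v k + ε : ℝ) : ℂ) ^ z * Wᴴ k j := fun z => by
      rw [Matrix.mul_apply]; simp only [mul_diagonal]
    simp only [h2]
    fun_prop
  · refine ⟨∑ i, max (v i + ε) 1, fun z h0 h1 => ?_⟩
    refine norm_conj_diagonal_le hW (Finset.sum_nonneg fun i _ => by positivity) fun i => ?_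
    rw [Complex.norm_cpow_eq_rpow_re_of_pos (hpos i)]
    refine le_trans ?_ (Finset.single_le_sum (f := fun i => max (v i + ε) 1)
      (fun i _ => by positivity) (Finset.mem_univ i))
    calc (v i + ε) ^ z.re ≤ (max (v i + ε) 1) ^ z.re :=
          Real.rpow_le_rpow (hpos i).le (le_max_left _ _) h0
      _ ≤ (max (v i + ε) 1) ^ (1 : ℝ) := Real.rpow_le_rpow_of_exponent_le (le_max_right _ _) h1
      _ = _ := Real.rpow_one _
  · have e : (W * diagonal (fun i => ((v i + ε : ℝ) : ℂ) ^ (t * Complex.I)) * Wᴴ)ᴴ =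
        W * diagonal (fun i => star (((v i + ε : ℝ) : ℂ) ^ (t * Complex.I))) * Wᴴ := by
      rw [conjTranspose_mul, conjTranspose_mul, conjTranspose_conjTranspose, diagonal_conjTranspose,
        Matrix.mul_assoc]
      rfl
    rw [e, conj_diagonal_mul hW]
    have : (fun i => star (((v i + ε : ℝ) : ℂ) ^ (t * Complex.I)) *
        ((v i + ε : ℝ) : ℂ) ^ (t * Complex.I)) = fun _ => 1 := by
      funext i
      have h := Complex.normSq_eq_conj_mul_self (z := ((v i + ε : ℝ) : ℂ) ^ (t * Complex.I))
      rw [Complex.star_def, ← h, Complex.normSq_eq_norm_sq,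
        Complex.norm_cpow_eq_rpow_re_of_pos (hpos i)]
      simp
    rw [this, conj_diagonal_one hW]
  · exact IsUnit.of_mul_eq_one_right _ (hinv z)
  · refine ⟨∑ i, (v i + ε)⁻¹, fun t => ⟨_, hinv _, ?_⟩⟩
    have h0 : ∀ i, 0 ≤ (v i + ε)⁻¹ := fun i => (inv_pos.mpr (hpos i)).le
    refine norm_conj_diagonal_le hW (Finset.sum_nonneg fun i _ => h0 i) fun i => ?_
    rw [Complex.norm_cpow_eq_rpow_re_of_pos (hpos i)]
    refine le_trans (le_of_eq ?_) (Finset.single_le_sum (f := fun i => (v i + ε)⁻¹)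
      (fun i _ => h0 i) (Finset.mem_univ i))
    simp [Real.rpow_neg_one]

/-- The ordered product of the powers `(A + ε) ^ z` over a list of matrices `A`. -/
noncomputable def prodCpow {d : ℕ} (l : List (Matrix (Fin d) (Fin d) ℂ)) (ε : ℝ) (z : ℂ) :
    Matrix (Fin d) (Fin d) ℂ :=
  (l.map fun A => matrixCpow (A + algebraMap ℂ _ (ε : ℂ)) z).prod

section prodCpow

variable {d : ℕ}

lemma prodCpow_cons (A : Matrix (Fin d) (Fin d) ℂ) (l : List (Matrix (Fin d) (Fin d) ℂ)) (ε : ℝ)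
    (z : ℂ) : prodCpow (A :: l) ε z =
      matrixCpow (A + algebraMap ℂ _ (ε : ℂ)) z * prodCpow l ε z := by
  simp [prodCpow]

lemma isStripFamily_prodCpow {l : List (Matrix (Fin d) (Fin d) ℂ)} (hl : ∀ A ∈ l, A.PosSemidef)
    {ε : ℝ} (hε : 0 < ε) : IsStripFamily (prodCpow l ε) := by
  induction l with
  | nil => exact isStripFamily_one
  | cons A l ih =>
    have h := (isStripFamily_matrixCpow (hl A (by simp)) hε).mul
      (ih fun B hB => hl B (by simp [hB]))
    simpa only [← prodCpow_cons] using h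

lemma tendsto_prodCpow {l : List (Matrix (Fin d) (Fin d) ℂ)} (hl : ∀ A ∈ l, A.PosSemidef)
    {z : ℂ} (hz : 0 < z.re) : Tendsto (fun ε => prodCpow l ε z) (𝓝 0) (𝓝 (prodCpow l 0 z)) := by
  induction l with
  | nil => exact tendsto_const_nhds
  | cons A l ih =>
    simp only [prodCpow_cons]
    refine Tendsto.mul ?_ (ih fun B hB => hl B (by simp [hB]))
    obtain ⟨W, v, hW, hv, hpow, -⟩ := exists_diagonalization (hl A (by simp))
    simp only [hpow]
    have h : Tendsto (fun (ε : ℝ) (i : Fin d) => ((v i + ε : ℝ) : ℂ) ^ z) (𝓝 0)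
        (𝓝 fun i => ((v i + 0 : ℝ) : ℂ) ^ z) := by
      refine tendsto_pi_nhds.mpr fun i => ?_
      have h1 : Tendsto (fun ε : ℝ => v i + ε) (𝓝 0) (𝓝 (v i + 0)) :=
        (continuous_const.add continuous_id).tendsto 0
      exact (Complex.continuousAt_ofReal_cpow_const _ z (Or.inl hz)).tendsto.comp h1
    exact ((continuous_conj_diagonal (X := ℝ) W).tendsto _).comp h

lemma exists_norm_prodCpow_le {l : List (Matrix (Fin d) (Fin d) ℂ)}
    (hl : ∀ A ∈ l, A.PosSemidef) :
    ∃ C, ∀ ε ∈ Set.Icc (0 : ℝ) 1, ∀ t : ℝ, ‖prodCpow l ε (1 + t * Complex.I)‖ ≤ C := by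
  induction l with
  | nil => exact ⟨‖(1 : Matrix (Fin d) (Fin d) ℂ)‖, fun _ _ _ => le_rfl⟩
  | cons A l ih =>
    obtain ⟨C, hC⟩ := ih fun B hB => hl B (by simp [hB])
    obtain ⟨W, v, hW, hv, hpow, -⟩ := exists_diagonalization (hl A (by simp))
    refine ⟨(∑ i, (v i + 1)) * C, fun ε hε t => ?_⟩
    have h0 : ∀ i, 0 ≤ v i + 1 := fun i => by linarith [hv i]
    rw [prodCpow_cons, hpow]
    refine (norm_mul_le _ _).trans (mul_le_mul ?_ (hC ε hε t) (norm_nonneg _)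
      (Finset.sum_nonneg fun i _ => h0 i))
    refine norm_conj_diagonal_le hW (Finset.sum_nonneg fun i _ => h0 i) fun i => ?_
    refine le_trans ?_ (Finset.single_le_sum (f := fun i => v i + 1)
      (fun i _ => h0 i) (Finset.mem_univ i))
    have hre : (1 + t * Complex.I : ℂ).re = 1 := by simp
    rw [Complex.norm_cpow_eq_rpow_re_of_nonneg (by linarith [hv i, hε.1]) (by simp [hre]), hre,
      Real.rpow_one]
    linarith [hε.2]

lemma continuous_prodCpow {l : List (Matrix (Fin d) (Fin d) ℂ)} (hl : ∀ A ∈ l, A.PosSemidef)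
    (ε : ℝ) : Continuous fun t : ℝ => prodCpow l ε (1 + t * Complex.I) := by
  induction l with
  | nil => exact continuous_const
  | cons A l ih =>
    simp only [prodCpow_cons]
    refine Continuous.mul ?_ (ih fun B hB => hl B (by simp [hB]))
    obtain ⟨W, v, hW, hv, hpow, -⟩ := exists_diagonalization (hl A (by simp))
    simp only [hpow]
    refine (continuous_conj_diagonal (X := ℝ) W).comp (continuous_pi fun i => ?_)
    refine Continuous.const_cpow (by fun_prop) (Or.inr fun t h => ?_)
    simpa using congrArg Complex.re h

lemma prodCpow_zero_ofReal {l : List (Matrix (Fin d) (Fin d) ℂ)} (hl : ∀ A ∈ l, A.PosSemidef)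
    (r : ℝ) : prodCpow l 0 r = (l.map (· ^ r)).prod := by
  rw [prodCpow]
  congr 1
  refine List.map_congr_left fun A hA => ?_
  obtain ⟨W, v, hW, hv, hpow, hr⟩ := exists_diagonalization (hl A hA)
  rw [hpow, hr]
  congr 3
  funext i
  rw [add_zero, Complex.ofReal_cpow (hv i)]

end prodCpow

/-! ### Extended integrals and passage to the limit -/

lemma erealIntegral_eq_integral {α : Type*} [MeasurableSpace α] {μ : Measure α} {f : α → EReal}
    {w : α → ℝ} (hw : Integrable w μ) (hf : ∀ᵐ x ∂μ, f x = w x) :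
    erealIntegral μ f = ((∫ x, w x ∂μ : ℝ) : EReal) := by
  have h1 : ∫⁻ x, (f x).toENNReal ∂μ = ∫⁻ x, ENNReal.ofReal (w x) ∂μ :=
    lintegral_congr_ae (hf.mono fun x hx => by simp [hx])
  have h2 : ∫⁻ x, (-f x).toENNReal ∂μ = ∫⁻ x, ENNReal.ofReal (-w x) ∂μ :=
    lintegral_congr_ae (hf.mono fun x hx => by
      simp only [hx]; rw [← EReal.coe_neg, EReal.real_coe_toENNReal])
  have f1 : ∫⁻ x, ENNReal.ofReal (w x) ∂μ ≠ ∞ := hw.lintegral_lt_top.ne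
  have f2 : ∫⁻ x, ENNReal.ofReal (-w x) ∂μ ≠ ∞ := hw.neg.lintegral_lt_top.ne
  rw [erealIntegral, h1, h2, integral_eq_lintegral_pos_part_sub_lintegral_neg_part hw,
    EReal.coe_sub, EReal.coe_ennreal_toReal f1, EReal.coe_ennreal_toReal f2]

lemma erealIntegral_dirac {α : Type*} [MeasurableSpace α] [MeasurableSingletonClass α] (a : α)
    (f : α → EReal) : erealIntegral (Measure.dirac a) f = f a := by
  rw [erealIntegral, lintegral_dirac, lintegral_dirac, EReal.coe_toENNReal_eq_max,
    EReal.coe_toENNReal_eq_max]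
  rcases le_total 0 (f a) with h | h
  · rw [max_eq_right h, max_eq_left (EReal.neg_le_zero.mpr h), sub_zero]
  · rw [max_eq_left h, max_eq_right (EReal.neg_nonneg.mpr h), zero_sub, neg_neg]

/-- A reverse Fatou argument: inequalities `log Φ ≤ ∫ log g` with a common upper bound for the
positive functions `g` survive pointwise limits, even if the limit function has zeros. -/
lemma log_le_erealIntegral_of_tendsto {α : Type*} [MeasurableSpace α] {μ : Measure α}
    [IsProbabilityMeasure μ] {g : ℕ → α → ℝ} {g₀ : α → ℝ} {Φ : ℕ → ℝ} {Φ₀ C : ℝ}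
    (hgm : ∀ j, Measurable (g j)) (hg₀m : Measurable g₀) (hg : ∀ j x, 0 < g j x)
    (hC : ∀ j x, g j x ≤ C) (hint : ∀ j, Integrable (fun x => Real.log (g j x)) μ)
    (hΦ : ∀ j, Real.log (Φ j) ≤ ∫ x, Real.log (g j x) ∂μ)
    (hlim : ∀ x, Tendsto (fun j => g j x) atTop (𝓝 (g₀ x))) (hΦlim : Tendsto Φ atTop (𝓝 Φ₀)) :
    ENNReal.log (ENNReal.ofReal Φ₀) ≤
      erealIntegral μ fun x => ENNReal.log (ENNReal.ofReal (g₀ x)) := by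
  rcases le_or_gt Φ₀ 0 with h0 | h0
  · rw [ENNReal.ofReal_of_nonpos h0, ENNReal.log_zero]; exact bot_le
  have hg₀ : ∀ x, 0 ≤ g₀ x := fun x => ge_of_tendsto' (hlim x) fun j => (hg j x).le
  have hC₀ : ∀ x, g₀ x ≤ C := fun x => le_of_tendsto' (hlim x) fun j => hC j x
  have hu0 : ∀ j x, 0 ≤ Real.log C - Real.log (g j x) := fun j x =>
    sub_nonneg.mpr (Real.log_le_log (hg j x) (hC j x))
  have huint : ∀ j, Integrable (fun x => Real.log C - Real.log (g j x)) μ := fun j =>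
    (integrable_const _).sub (hint j)
  have hI : ∀ j, ∫ x, (Real.log C - Real.log (g j x)) ∂μ ≤ Real.log C - Real.log (Φ j) := by
    intro j
    rw [integral_sub (integrable_const _) (hint j), integral_const, probReal_univ, one_smul]
    linarith [hΦ j]
  have hKlim : Tendsto (fun j => Real.log C - Real.log (Φ j)) atTop
      (𝓝 (Real.log C - Real.log Φ₀)) := tendsto_const_nhds.sub (hΦlim.log h0.ne')
  have hK0 : 0 ≤ Real.log C - Real.log Φ₀ :=
    ge_of_tendsto' hKlim fun j => (integral_nonneg (hu0 j)).trans (hI j)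
  -- Fatou's lemma for the nonnegative functions `log C - log g`.
  have hfatou : ∫⁻ x, liminf (fun j => ENNReal.ofReal (Real.log C - Real.log (g j x))) atTop ∂μ ≤
      ENNReal.ofReal (Real.log C - Real.log Φ₀) := by
    refine (lintegral_liminf_le fun j =>
      (measurable_const.sub (Real.measurable_log.comp (hgm j))).ennreal_ofReal).trans ?_
    rw [← (ENNReal.tendsto_ofReal hKlim).liminf_eq]
    refine liminf_le_liminf (.of_forall fun j => ?_)
    change ∫⁻ x, ENNReal.ofReal (Real.log C - Real.log (g j x)) ∂μ ≤ _
    rw [← ofReal_integral_eq_lintegral_ofReal (huint j) (.of_forall (hu0 j))]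
    exact ENNReal.ofReal_le_ofReal (hI j)
  have hmeas : Measurable fun x =>
      liminf (fun j => ENNReal.ofReal (Real.log C - Real.log (g j x))) atTop :=
    Measurable.liminf fun j =>
      (measurable_const.sub (Real.measurable_log.comp (hgm j))).ennreal_ofReal
  have hpos : ∀ᵐ x ∂μ, 0 < g₀ x := by
    filter_upwards [ae_lt_top hmeas (hfatou.trans_lt ENNReal.ofReal_lt_top).ne] with x hx
    refine lt_of_le_of_ne (hg₀ x) fun h => hx.ne ?_
    have h1 : Tendsto (fun j => Real.log (g j x)) atTop atBot := by
      refine Real.tendsto_log_nhdsGT_zero.comp (tendsto_nhdsWithin_iff.mpr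
        ⟨?_, .of_forall (hg · x)⟩)
      simpa [← h] using hlim x
    have h2 : Tendsto (fun j => Real.log C - Real.log (g j x)) atTop atTop := by
      simpa [sub_eq_add_neg] using
        tendsto_atTop_add_const_left _ (Real.log C) (tendsto_neg_atBot_atTop.comp h1)
    exact (ENNReal.tendsto_ofReal_atTop.comp h2).liminf_eq
  have heq : ∀ᵐ x ∂μ, liminf (fun j => ENNReal.ofReal (Real.log C - Real.log (g j x))) atTop =
      ENNReal.ofReal (Real.log C - Real.log (g₀ x)) := by
    filter_upwards [hpos] with x hx
    exact (ENNReal.tendsto_ofReal (tendsto_const_nhds.sub ((hlim x).log hx.ne'))).liminf_eq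
  rw [lintegral_congr_ae heq] at hfatou
  have hu₀ : ∀ᵐ x ∂μ, 0 ≤ Real.log C - Real.log (g₀ x) := by
    filter_upwards [hpos] with x hx
    exact sub_nonneg.mpr (Real.log_le_log hx (hC₀ x))
  have hum : Measurable fun x => Real.log C - Real.log (g₀ x) :=
    measurable_const.sub (Real.measurable_log.comp hg₀m)
  have hui : Integrable (fun x => Real.log C - Real.log (g₀ x)) μ := by
    refine ⟨hum.aestronglyMeasurable, ?_⟩
    rw [hasFiniteIntegral_iff_ofReal hu₀]
    exact hfatou.trans_lt ENNReal.ofReal_lt_top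
  have hwi : Integrable (fun x => Real.log (g₀ x)) μ := by
    have := (integrable_const (Real.log C)).sub hui
    refine this.congr (.of_forall fun x => ?_)
    simp
  rw [erealIntegral_eq_integral hwi (hpos.mono fun x hx => ENNReal.log_ofReal_of_pos hx),
    ENNReal.log_ofReal_of_pos h0, EReal.coe_le_coe_iff]
  rw [← ofReal_integral_eq_lintegral_ofReal hui hu₀, ENNReal.ofReal_le_ofReal_iff hK0,
    integral_sub (integrable_const _) hwi, integral_const, probReal_univ, one_smul] at hfatou
  linarith

/-! ### Schatten norms -/

lemma schattenNorm_abs_rpow {d : ℕ} {p : ℝ≥0∞} {θ : ℝ} (hθ : 0 < θ)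
    (X : Matrix (Fin d) (Fin d) ℂ) : schattenNorm p (CFC.abs X ^ (1 / θ)) =
      if p = ∞ then ‖X‖ ^ (1 / θ)
      else (trace (CFC.abs X ^ (p.toReal / θ))).re ^ (1 / p.toReal) := by
  unfold schattenNorm
  split_ifs with h
  · rw [CFC.norm_rpow _ (by positivity) (CFC.abs_nonneg X), CFC.norm_abs]
  · rw [CFC.abs_of_nonneg _ CFC.rpow_nonneg, CFC.rpow_rpow_of_exponent_nonneg _ _ _ (by positivity)
      (by positivity) (CFC.abs_nonneg X), one_div_mul_eq_div]

lemma schattenNorm_pos {d : ℕ} [NeZero d] (p : ℝ≥0∞) {X : Matrix (Fin d) (Fin d) ℂ}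
    (hX : IsUnit X) : 0 < schattenNorm p X := by
  unfold schattenNorm
  split_ifs with h
  · exact norm_pos_iff.mpr hX.ne_zero
  · obtain ⟨U, V, s, -, -, hs, -, -, -, htr⟩ := exists_sorted_svd hX
    rw [htr]
    exact Real.rpow_pos_of_pos (Finset.sum_pos (fun i _ => Real.rpow_pos_of_pos (hs i) _)
      Finset.univ_nonempty) _

/-- The asserted inequality for a strip family, where all quantities are finite. -/
theorem IsStripFamily.log_schattenNorm_le {d : ℕ} [NeZero d] {F : ℂ → Matrix (Fin d) (Fin d) ℂ}
    (hF : IsStripFamily F) {θ : ℝ} (hθ : θ ∈ Set.Ioo (0 : ℝ) 1) {p : ℝ≥0∞} (hp : 0 < p) :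
    Integrable (fun t : ℝ => Real.log (schattenNorm p (F (1 + t * Complex.I))))
      (hirschmanMeasure θ) ∧
    Real.log (schattenNorm p (CFC.abs (F θ) ^ (1 / θ))) ≤
      ∫ t : ℝ, Real.log (schattenNorm p (F (1 + t * Complex.I))) ∂(hirschmanMeasure θ) := by
  rw [schattenNorm_abs_rpow hθ.1]
  unfold schattenNorm
  split_ifs with h
  · obtain ⟨h1, h2, h3⟩ := hF.log_norm_le hθ
    refine ⟨h1, ?_⟩
    rw [Real.log_rpow h2, one_div, inv_mul_le_iff₀ hθ.1]
    exact h3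
  · have hq : 0 < p.toReal := ENNReal.toReal_pos hp.ne' h
    obtain ⟨h1, h2, h3⟩ := hF.log_trace_le hθ hq
    have hlog : ∀ t : ℝ, Real.log ((trace (CFC.abs (F (1 + t * Complex.I)) ^ p.toReal)).re ^
        (1 / p.toReal)) = 1 / p.toReal *
          Real.log (trace (CFC.abs (F (1 + t * Complex.I)) ^ p.toReal)).re := by
      intro t
      obtain ⟨U, V, s, -, -, hs, -, -, -, htr⟩ := exists_sorted_svd (hF.isUnit (1 + t * Complex.I))
      rw [Real.log_rpow]
      rw [htr]
      exact Finset.sum_pos (fun i _ => Real.rpow_pos_of_pos (hs i) _) Finset.univ_nonempty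
    simp only [hlog]
    refine ⟨h1.const_mul _, ?_⟩
    rw [Real.log_rpow h2, integral_const_mul]
    exact mul_le_mul_of_nonneg_left h3 (by positivity)

/-! ### The inequality for positive semidefinite matrices -/

lemma schattenNorm_fin_zero {d : ℕ} (hd : d = 0) {p : ℝ≥0∞} (hp : 0 < p)
    (X : Matrix (Fin d) (Fin d) ℂ) : schattenNorm p X = 0 := by
  subst hd
  have hX : X = 0 := Subsingleton.elim _ _
  unfold schattenNorm
  split_ifs with h
  · rw [hX, norm_zero]
  · have hq : 0 < p.toReal := ENNReal.toReal_pos hp.ne' h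
    rw [trace_fin_zero, Complex.zero_re, Real.zero_rpow (by positivity)]

theorem mainTheorem10 (d n : ℕ) (p : ℝ≥0∞) (hp : 0 < p) (r : ℝ) (hr : r ∈ Set.Ioc (0 : ℝ) 1)
    (A : Fin n → Matrix (Fin d) (Fin d) ℂ) (hA : ∀ k, (A k).PosSemidef) :
    let logNorm : ℝ → EReal := fun t =>
      logSchattenNorm p (List.ofFn fun k => matrixCpow (A k) (1 + (t : ℂ) * Complex.I)).prod
    Measurable logNorm ∧
      ∫⁻ t, (logNorm t).toENNReal ∂(hirschmanMeasure r) ≠ ∞ ∧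
      logSchattenNorm p (CFC.abs (List.ofFn fun k => A k ^ r).prod ^ (1 / r)) ≤
        erealIntegral (hirschmanMeasure r) logNorm := by
  intro logNorm
  set l := List.ofFn A with hl
  have hpsd : ∀ B ∈ l, B.PosSemidef := by
    intro B hB
    obtain ⟨k, rfl⟩ := (List.mem_ofFn' A B).mp hB
    exact hA k
  have hprod : ∀ z : ℂ, (List.ofFn fun k => matrixCpow (A k) z).prod = prodCpow l 0 z := by
    intro z
    rw [prodCpow, hl, List.map_ofFn]
    simp [Function.comp_def]
  have hprodr : (List.ofFn fun k => A k ^ r).prod = prodCpow l 0 r := by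
    rw [prodCpow_zero_ofReal hpsd, hl, List.map_ofFn]
    rfl
  have hlogNorm : logNorm = fun t : ℝ =>
      ENNReal.log (ENNReal.ofReal (schattenNorm p (prodCpow l 0 (1 + t * Complex.I)))) := by
    funext t
    simp only [logNorm, hprod, logSchattenNorm]
  have hcont : ∀ ε, Continuous fun t : ℝ => schattenNorm p (prodCpow l ε (1 + t * Complex.I)) :=
    fun ε => (continuous_schattenNorm hp).comp (continuous_prodCpow hpsd ε)
  have hprob : IsProbabilityMeasure (hirschmanMeasure r) := by
    rcases eq_or_lt_of_le hr.2 with h1 | h1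
    · rw [hirschmanMeasure, if_pos h1]; infer_instance
    · exact isProbabilityMeasure_hirschmanMeasure ⟨hr.1, h1⟩
  obtain ⟨C, hC⟩ := exists_norm_prodCpow_le hpsd
  obtain ⟨K, hK⟩ :=
    (isCompact_closedBall (0 : Matrix (Fin d) (Fin d) ℂ) C).exists_bound_of_continuousOn
    (continuous_schattenNorm hp).continuousOn
  have hbound : ∀ ε ∈ Set.Icc (0 : ℝ) 1, ∀ t : ℝ,
      schattenNorm p (prodCpow l ε (1 + t * Complex.I)) ≤ K := fun ε hε t =>
    (le_abs_self _).trans (hK _ (by simpa using hC ε hε t))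
  have hmeas : Measurable logNorm := by
    rw [hlogNorm]
    exact ENNReal.measurable_log.comp (hcont 0).measurable.ennreal_ofReal
  refine ⟨hmeas, ?_, ?_⟩
  · have hle : ∀ t, (logNorm t).toENNReal ≤ (ENNReal.log (ENNReal.ofReal K)).toENNReal := by
      intro t
      rw [hlogNorm]
      exact EReal.toENNReal_le_toENNReal (ENNReal.log_le_log
        (ENNReal.ofReal_le_ofReal (hbound 0 (by simp) t)))
    refine ((lintegral_mono hle).trans_lt ?_).ne
    rw [lintegral_const, measure_univ, mul_one, lt_top_iff_ne_top, EReal.toENNReal_ne_top_iff, Ne,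
      ENNReal.log_eq_top_iff]
    exact ENNReal.ofReal_ne_top
  rw [hprodr, logSchattenNorm]
  by_cases hd : d = 0
  · rw [schattenNorm_fin_zero hd hp, ENNReal.ofReal_zero, ENNReal.log_zero]
    exact bot_le
  have : NeZero d := ⟨hd⟩
  rcases eq_or_lt_of_le hr.2 with h1 | h1
  -- For `r = 1` both sides are `log ‖∏ A k‖_p`.
  · subst h1
    rw [hirschmanMeasure, if_pos rfl, erealIntegral_dirac, hlogNorm, schattenNorm_abs_rpow one_pos]
    simp [schattenNorm]
  have hθ : r ∈ Set.Ioo (0 : ℝ) 1 := ⟨hr.1, h1⟩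
  rw [hlogNorm]
  -- Apply the inequality to the positive definite matrices `A k + ε j` and let `ε j` tend to `0`.
  set ε : ℕ → ℝ := fun j => 1 / ((j : ℝ) + 1) with hε
  have hε0 : ∀ j, 0 < ε j := fun j => by positivity
  have hε1 : ∀ j, ε j ≤ 1 := fun j => by
    rw [hε]; exact (div_le_one (by positivity)).mpr (by linarith [Nat.cast_nonneg (α := ℝ) j])
  have hεlim : Tendsto ε atTop (𝓝 0) := tendsto_one_div_add_atTop_nhds_zero_nat
  have hfam : ∀ j, IsStripFamily (prodCpow l (ε j)) := fun j => isStripFamily_prodCpow hpsd (hε0 j)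
  have hΦcont : Continuous fun X : Matrix (Fin d) (Fin d) ℂ =>
      schattenNorm p (CFC.abs X ^ (1 / r)) :=
    (continuous_schattenNorm hp).comp (continuous_abs_rpow (by have := hr.1; positivity))
  refine log_le_erealIntegral_of_tendsto (C := K)
    (g := fun j (t : ℝ) => schattenNorm p (prodCpow l (ε j) (1 + t * Complex.I)))
    (Φ := fun j => schattenNorm p (CFC.abs (prodCpow l (ε j) r) ^ (1 / r)))
    (fun j => (hcont _).measurable) (hcont 0).measurable
    (fun j t => schattenNorm_pos p ((hfam j).isUnit _))
    (fun j t => hbound _ ⟨(hε0 j).le, hε1 j⟩ t)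
    (fun j => ((hfam j).log_schattenNorm_le hθ hp).1)
    (fun j => ((hfam j).log_schattenNorm_le hθ hp).2) (fun t => ?_) ?_
  · exact ((continuous_schattenNorm hp).tendsto _).comp
      ((tendsto_prodCpow hpsd (by simp)).comp hεlim)
  · exact (hΦcont.tendsto _).comp ((tendsto_prodCpow hpsd (by simpa using hr.1)).comp hεlim)
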